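/- **Setting.** Let $q\ge 3$ be an integer, $\lambda=2\cos(\pi/q)$, $G=\mathrm{PSL}_2(\mathbb R)$, acting on $P^1(\mathbb R)=\mathbb R\cup\{\infty\}$ by fractional linear transformations; order $P^1(\mathbb R)$ by the usual order on $\mathbb R$ and $r<\infty$ for $r\in\mathbb R$. Let $\Gamma=\Gamma_q\le G$ be the Hecke triangle group generated by $S=\begin{bmatrix}0&1\\-1&0\end{bmatrix}$ and $T=\begin{bmatrix}1&\lambda\\0&1\end{bmatrix}$. Put $U=TS$ and $g_k=(U^kS)^{-1}$. For $k=1,\dots,q-1$ the intervals $(g_k^{-1}.0,\,g_k^{-1}.\infty)$ are pairwise disjoint subsets of $(0,\infty)$; for $x$ in the $k$-th of them let $\mathrm{interval}(x)=k$. For real $A,B,C$ with $D=B^2-4AC>0$ let $f=[A,B,C]=Ax^2+Bxy+Cy^2$, with zeros $x_\pm(f)=\frac{-B\pm\sqrt D}{2A}$ (for $A=0$: $x_+=-C/B$, $x_-=\infty$ if $B>0$, and $x_+=\infty$, $x_-=-C/B$ if $B<0$). A projective oriented form is a class $F=[f,s]=\{(f,s),(-f,-s)\}$ with $s=\pm1$.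 Its attracting and repelling zeros are $(x_a(F),x_r(F))=(x_+(f),x_-(f))$ if $s=1$ and $(x_-(f),x_+(f))$ if $s=-1$. The group $G$ acts by $g.[f,s]=[f\circ g^{-1},s]$. The map $$\psi([A,B,C,s])=\begin{bmatrix}\frac{-B+s\sqrt{D+4}}2&-C\\A&\frac{B+s\sqrt{D+4}}2\end{bmatrix}$$ is a bijection from the projective oriented forms onto the hyperbolic elements of $G$, with inverse $\psi^{-1}\begin{bmatrix}a&b\\c&d\end{bmatrix}=[c,d-a,-b,\mathrm{sgn}(a+d)]$. A $\Gamma$-form is an $F$ with $\psi(F)\in\Gamma$; $\psi(F)$ is its associated hyperbolic element. The level of $F$ is the maximal $n\ge1$ such that $\psi(F)=h^n$ for some $h\in\Gamma$. Two forms are equivalent if they lie in the same $\Gamma$-orbit. $F$ is reduced if $x_a(F)>0>x_r(F)$. **Algorithm.** Input: a $\Gamma$-form $F$. 1. *Initialization.* $F_0\gets F$, $(x_0,y_0)\gets(x_a(F),x_r(F))$, $h_0\gets\mathrm{id}$, $j\gets0$. If $x_0<0$, then $F_1\gets S.F_0$, $(x_1,y_1)\gets(S.x_0,S.y_0)$,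 $h_1\gets S$, $j\gets1$. 2. *Preperiod.* While $F_j$ is not reduced: $k\gets\mathrm{interval}(x_j)$, $F_{j+1}\gets g_k.F_j$, $(x_{j+1},y_{j+1})\gets g_k.(x_j,y_j)$, $h_{j+1}\gets h_jg_k^{-1}$, $j\gets j+1$. Afterwards $m\gets j$. 3. *Period.* $a_0\gets\mathrm{id}$. Repeat: $k\gets\mathrm{interval}(x_j)$, $F_{j+1}\gets g_k.F_j$, $(x_{j+1},y_{j+1})\gets g_k.(x_j,y_j)$, $j\gets j+1$, $a_{j-m}\gets a_{j-m-1}g_k^{-1}$; until $(x_j,y_j)=(x_m,y_m)$. Afterwards $p\gets j-m$. 4. *Level.* $n\gets1$. While $\psi^{-1}(h_ma_p^nh_m^{-1})\ne F$: $n\gets n+1$. 5. *Output.* The level $n$, the preperiod $F_0,\dots,F_m$, the period $F_{m+1},\dots,F_{m+p}$, and the element $h_ma_p^nh_m^{-1}$. **Theorem.** For every $\Gamma$-form $F$ the algorithm is well defined at every step (in particular, $\mathrm{interval}(x_j)$ is defined whenever it is called) and terminates, and its output has the following properties. * The preperiod starts with $F_0=F$; all its members are $\Gamma$-forms equivalent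 to $F$; $F_0,\dots,F_{m-1}$ are not reduced, and $F_m$ is reduced. * The period is a cycle: $F_{m+p}=F_m$, and each member $E$ of the period is followed cyclically by $g_k.E$ with $k=\mathrm{interval}(x_a(E))$. * The forms $F_{m+1},\dots,F_{m+p}$ are pairwise distinct, and they are exactly the reduced $\Gamma$-forms equivalent to $F$. * The returned number $n$ is the level of $F$, and the returned element $h_ma_p^nh_m^{-1}$ is $\psi(F)$, the hyperbolic element of $\Gamma$ associated to $F$. -/

import Mathlib

namespace HeckeReduction

open Matrix OnePoint

noncomputable section

/-! ### The group `PSL₂(ℝ)` and its action on `P¹(ℝ) = ℝ ∪ {∞}` -/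

/-- The group `SL₂(ℝ)`. -/
abbrev SL2R : Type := Matrix.SpecialLinearGroup (Fin 2) ℝ

/-- The group `G = PSL₂(ℝ) = SL₂(ℝ) / {±1}`. -/
abbrev PSL2R : Type := Matrix.ProjectiveSpecialLinearGroup (Fin 2) ℝ

theorem eq_one_or_neg_one_of_sq {r : ℝ} (h : r ^ 2 = 1) : r = 1 ∨ r = -1 := by
  have : (r - 1) * (r + 1) = 0 := by linarith
  rcases mul_eq_zero.1 this with h | h
  · exact Or.inl (by linarith)
  · exact Or.inr (by linarith)

theorem center_eq_one_or_neg {A : SL2R} (hA : A ∈ Subgroup.center SL2R) : A = 1 ∨ A = -1 := by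
  obtain ⟨r, hr, hrA⟩ := Matrix.SpecialLinearGroup.mem_center_iff.1 hA
  have h2 : r ^ 2 = 1 := by simpa using hr
  rcases eq_one_or_neg_one_of_sq h2 with h | h
  · left
    apply Subtype.ext
    rw [← hrA, h]
    simp
  · right
    apply Subtype.ext
    rw [← hrA, h]
    ext i j
    fin_cases i <;> fin_cases j <;> simp

theorem neg_one_mem_center : (-1 : SL2R) ∈ Subgroup.center SL2R := by
  rw [Subgroup.mem_center_iff]
  intro g
  simp

theorem mk_neg (A : SL2R) : ((-A : SL2R) : PSL2R) = (A : PSL2R) := by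
  rw [eq_comm, QuotientGroup.eq]
  have : A⁻¹ * -A = -1 := by simp
  rw [this]
  exact neg_one_mem_center

theorem mk_eq_mk_iff (A B : SL2R) : (A : PSL2R) = (B : PSL2R) ↔ B = A ∨ B = -A := by
  constructor
  · intro h
    rw [QuotientGroup.eq] at h
    rcases center_eq_one_or_neg h with h | h
    · left
      exact (inv_mul_eq_one.1 h).symm
    · right
      have := congrArg (fun X => A * X) h
      simpa using this
  · rintro (rfl | rfl)
    · rfl
    · exact (mk_neg A).symm

/-- The permutation representation of `PSL₂(ℝ)` on `P¹(ℝ)` induced by the action of `GL₂(ℝ)` by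
fractional linear transformations. -/
def boundaryPermHom : PSL2R →* Equiv.Perm (OnePoint ℝ) :=
  QuotientGroup.lift (Subgroup.center SL2R)
    ((MulAction.toPermHom (GL (Fin 2) ℝ) (OnePoint ℝ)).comp Matrix.SpecialLinearGroup.toGL) (by
      intro A hA
      rw [MonoidHom.mem_ker]
      rcases center_eq_one_or_neg hA with rfl | rfl
      · exact map_one _
      · ext x
        induction x using OnePoint.rec with
        | infty => simp [OnePoint.smul_infty_eq_ite]
        | coe x => simp [OnePoint.smul_some_eq_ite])

instance boundaryAction : MulAction PSL2R (OnePoint ℝ) :=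
  MulAction.compHom _ boundaryPermHom

/-- An element of `PSL₂(ℝ)` is hyperbolic if one (equivalently, each) of its two representatives
`A` in `SL₂(ℝ)` is, i.e. if `tr(A)² - 4 det(A) > 0`. -/
def IsHyp (g : PSL2R) : Prop :=
  ∃ A : SL2R, (A : PSL2R) = g ∧ (A : Matrix (Fin 2) (Fin 2) ℝ).IsHyperbolic

theorem isHyp_mk (A : SL2R) :
    IsHyp (A : PSL2R) ↔ (A : Matrix (Fin 2) (Fin 2) ℝ).IsHyperbolic := by
  constructor
  · rintro ⟨B, hB, h⟩
    rcases (mk_eq_mk_iff B A).1 hB with rfl | rfl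
    · exact h
    · simpa using h.neg
  · exact fun h => ⟨A, rfl, h⟩

/-- The auxiliary linear order on `P¹(ℝ)`: the usual order on `ℝ`, together with `r < ∞` for all
`r ∈ ℝ`. Points are compared through their images in `WithTop ℝ`. -/
def toOrd (x : OnePoint ℝ) : WithTop ℝ :=
  OnePoint.elim x (⊤ : WithTop ℝ) (fun r : ℝ => (r : WithTop ℝ))

/-! ### Indefinite binary quadratic forms -/

/-- The indefinite binary quadratic form `[A, B, C] = A x² + B x y + C y²` over `ℝ`. -/
@[ext]
structure QF where
  A : ℝ
  B : ℝ
  C : ℝ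
  indefinite : 0 < discrim A B C

namespace QF

/-- The discriminant `D = B² - 4 A C`. -/
def D (f : QF) : ℝ := discrim f.A f.B f.C

instance : Neg QF :=
  ⟨fun f => ⟨-f.A, -f.B, -f.C, by simpa [discrim] using f.indefinite⟩⟩

/-- The zero `x₊`; for `A = 0` it is the zero of `f` at which `f(x, 1)` increases, or `∞`. -/
def xPlus (f : QF) : OnePoint ℝ :=
  if f.A = 0 then
    if 0 < f.B then ((-f.C / f.B : ℝ) : OnePoint ℝ) else ∞
  else (((-f.B + √f.D) / (2 * f.A) : ℝ) : OnePoint ℝ)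

/-- The zero `x₋`. -/
def xMinus (f : QF) : OnePoint ℝ :=
  if f.A = 0 then
    if 0 < f.B then ∞ else ((-f.C / f.B : ℝ) : OnePoint ℝ)
  else (((-f.B - √f.D) / (2 * f.A) : ℝ) : OnePoint ℝ)

theorem neg_A (f : QF) : (-f).A = -f.A := rfl
theorem neg_B (f : QF) : (-f).B = -f.B := rfl
theorem neg_C (f : QF) : (-f).C = -f.C := rfl

theorem neg_neg' (f : QF) : - -f = f := by
  ext <;> simp [neg_A, neg_B, neg_C]

theorem neg_D (f : QF) : (-f).D = f.D := by
  simp [D, neg_A, neg_B, neg_C, discrim]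

theorem xPlus_neg (f : QF) : (-f).xPlus = f.xMinus := by
  have hB : f.A = 0 → f.B ≠ 0 := by
    intro hA hB
    have := f.indefinite
    simp [discrim, hA, hB] at this
  unfold xPlus xMinus
  simp only [neg_A, neg_B, neg_C, neg_D, neg_eq_zero]
  split_ifs with h1 h2 h3 h3
  · linarith
  · rw [neg_div_neg_eq]
  · rfl
  · exact absurd (le_antisymm (not_lt.1 h3) (by linarith)) (hB h1)
  · congr 1
    rw [← neg_div_neg_eq]
    congr 1 <;> ring

theorem xMinus_neg (f : QF) : (-f).xMinus = f.xPlus := by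
  rw [← xPlus_neg, neg_neg']

/-- For `g` with rows `(a, b)`, `(c, d)`, the form `(g.f)(x, y) = f(d x - b y, -c x + a y)`. -/
instance : MulAction SL2R QF where
  smul g f :=
    { A := f.A * g 1 1 ^ 2 - f.B * g 1 0 * g 1 1 + f.C * g 1 0 ^ 2
      B := -2 * f.A * g 0 1 * g 1 1 + f.B * (g 0 0 * g 1 1 + g 0 1 * g 1 0)
        - 2 * f.C * g 0 0 * g 1 0
      C := f.A * g 0 1 ^ 2 - f.B * g 0 1 * g 0 0 + f.C * g 0 0 ^ 2
      indefinite := by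
        have hdet := g.det_coe
        rw [Matrix.det_fin_two] at hdet
        have hf := f.indefinite
        have key : discrim
            (f.A * g 1 1 ^ 2 - f.B * g 1 0 * g 1 1 + f.C * g 1 0 ^ 2)
            (-2 * f.A * g 0 1 * g 1 1 + f.B * (g 0 0 * g 1 1 + g 0 1 * g 1 0)
              - 2 * f.C * g 0 0 * g 1 0)
            (f.A * g 0 1 ^ 2 - f.B * g 0 1 * g 0 0 + f.C * g 0 0 ^ 2)
            = discrim f.A f.B f.C * (g 0 0 * g 1 1 - g 0 1 * g 1 0) ^ 2 := by
          unfold discrim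
          ring
        rw [key, hdet]
        simpa using hf }
  one_smul f := by
    ext
    · change f.A * _ ^ 2 - f.B * _ * _ + f.C * _ ^ 2 = f.A
      simp
    · change -2 * f.A * _ * _ + f.B * (_ * _ + _ * _) - 2 * f.C * _ * _ = f.B
      simp
    · change f.A * _ ^ 2 - f.B * _ * _ + f.C * _ ^ 2 = f.C
      simp
  mul_smul g h f := by
    ext
    · change f.A * (g * h) 1 1 ^ 2 - f.B * (g * h) 1 0 * (g * h) 1 1 + f.C * (g * h) 1 0 ^ 2
        = (f.A * h 1 1 ^ 2 - f.B * h 1 0 * h 1 1 + f.C * h 1 0 ^ 2) * g 1 1 ^ 2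
          - (-2 * f.A * h 0 1 * h 1 1 + f.B * (h 0 0 * h 1 1 + h 0 1 * h 1 0)
              - 2 * f.C * h 0 0 * h 1 0) * g 1 0 * g 1 1
          + (f.A * h 0 1 ^ 2 - f.B * h 0 1 * h 0 0 + f.C * h 0 0 ^ 2) * g 1 0 ^ 2
      simp only [Matrix.SpecialLinearGroup.coe_mul, Matrix.mul_apply, Fin.sum_univ_two]
      ring
    · change -2 * f.A * (g * h) 0 1 * (g * h) 1 1
          + f.B * ((g * h) 0 0 * (g * h) 1 1 + (g * h) 0 1 * (g * h) 1 0)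
          - 2 * f.C * (g * h) 0 0 * (g * h) 1 0
        = -2 * (f.A * h 1 1 ^ 2 - f.B * h 1 0 * h 1 1 + f.C * h 1 0 ^ 2) * g 0 1 * g 1 1
          + (-2 * f.A * h 0 1 * h 1 1 + f.B * (h 0 0 * h 1 1 + h 0 1 * h 1 0)
              - 2 * f.C * h 0 0 * h 1 0) * (g 0 0 * g 1 1 + g 0 1 * g 1 0)
          - 2 * (f.A * h 0 1 ^ 2 - f.B * h 0 1 * h 0 0 + f.C * h 0 0 ^ 2) * g 0 0 * g 1 0
      simp only [Matrix.SpecialLinearGroup.coe_mul, Matrix.mul_apply, Fin.sum_univ_two]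
      ring
    · change f.A * (g * h) 0 1 ^ 2 - f.B * (g * h) 0 1 * (g * h) 0 0 + f.C * (g * h) 0 0 ^ 2
        = (f.A * h 1 1 ^ 2 - f.B * h 1 0 * h 1 1 + f.C * h 1 0 ^ 2) * g 0 1 ^ 2
          - (-2 * f.A * h 0 1 * h 1 1 + f.B * (h 0 0 * h 1 1 + h 0 1 * h 1 0)
              - 2 * f.C * h 0 0 * h 1 0) * g 0 1 * g 0 0
          + (f.A * h 0 1 ^ 2 - f.B * h 0 1 * h 0 0 + f.C * h 0 0 ^ 2) * g 0 0 ^ 2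
      simp only [Matrix.SpecialLinearGroup.coe_mul, Matrix.mul_apply, Fin.sum_univ_two]
      ring

theorem smul_A (g : SL2R) (f : QF) :
    (g • f).A = f.A * g 1 1 ^ 2 - f.B * g 1 0 * g 1 1 + f.C * g 1 0 ^ 2 := rfl
theorem smul_B (g : SL2R) (f : QF) :
    (g • f).B = -2 * f.A * g 0 1 * g 1 1 + f.B * (g 0 0 * g 1 1 + g 0 1 * g 1 0)
      - 2 * f.C * g 0 0 * g 1 0 := rfl
theorem smul_C (g : SL2R) (f : QF) :
    (g • f).C = f.A * g 0 1 ^ 2 - f.B * g 0 1 * g 0 0 + f.C * g 0 0 ^ 2 := rfl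

theorem smul_neg' (g : SL2R) (f : QF) : g • (-f) = -(g • f) := by
  ext <;> simp only [smul_A, smul_B, smul_C, neg_A, neg_B, neg_C] <;> ring

theorem neg_one_smul' (f : QF) : (-1 : SL2R) • f = f := by
  ext <;> simp [smul_A, smul_B, smul_C]

end QF

/-- Oriented quadratic forms `(f, s)` with `s = ±1`. -/
abbrev OQF : Type := QF × ℤˣ

namespace OQF

/-- `(f, s)` and `(-f, -s)` are identified. -/
instance setoid : Setoid OQF where
  r F F' := F' = F ∨ F' = (-F.1, -F.2)
  iseqv :=
    { refl := fun _ => Or.inl rfl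
      symm := by
        rintro ⟨f, s⟩ ⟨f', s'⟩ (h | h)
        · exact Or.inl h.symm
        · right
          rw [h]
          simp [QF.neg_neg']
      trans := by
        rintro ⟨f, s⟩ ⟨f', s'⟩ ⟨f'', s''⟩ (h | h) (h' | h')
        · exact Or.inl (h'.trans h)
        · right
          rw [h', h]
        · right
          rw [h', h]
        · left
          rw [h', h]
          simp [QF.neg_neg'] }

/-- The attracting zero of `(f, s)`: `x₊` if `s = 1`, and `x₋` if `s = -1`. -/
def attr (F : OQF) : OnePoint ℝ := if F.2 = 1 then F.1.xPlus else F.1.xMinus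

/-- The repelling zero of `(f, s)`: `x₋` if `s = 1`, and `x₊` if `s = -1`. -/
def rep (F : OQF) : OnePoint ℝ := if F.2 = 1 then F.1.xMinus else F.1.xPlus

/-- The representative in `SL₂(ℝ)` of the hyperbolic element attached to `(f, s)`, with rows
`((-B + s √(D+4)) / 2, -C)` and `(A, (B + s √(D+4)) / 2)`. -/
def toSL (F : OQF) : SL2R :=
  ⟨!![(-F.1.B + ((F.2 : ℤ) : ℝ) * √(F.1.D + 4)) / 2, -F.1.C;
      F.1.A, (F.1.B + ((F.2 : ℤ) : ℝ) * √(F.1.D + 4)) / 2], by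
    have hD : 0 < F.1.D := F.1.indefinite
    have hs : ((F.2 : ℤ) : ℝ) ^ 2 = 1 := by
      rcases Int.units_eq_one_or F.2 with h | h <;> simp [h]
    have hsq : √(F.1.D + 4) ^ 2 = F.1.D + 4 := Real.sq_sqrt (by linarith)
    have hDef : F.1.D = F.1.B ^ 2 - 4 * F.1.A * F.1.C := rfl
    rw [Matrix.det_fin_two_of]
    have : (((F.2 : ℤ) : ℝ) * √(F.1.D + 4)) ^ 2 = F.1.D + 4 := by
      rw [mul_pow, hs, hsq, one_mul]
    nlinarith [this, hDef]⟩

end OQF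

/-- Projective oriented quadratic forms `[f, s] = {(f, s), (-f, -s)}`. -/
def POQF : Type := Quotient OQF.setoid

namespace POQF

/-- The projective oriented quadratic form `[f, s]`. -/
def mk (f : QF) (s : ℤˣ) : POQF := Quotient.mk OQF.setoid (f, s)

theorem mk_neg (f : QF) (s : ℤˣ) : mk (-f) (-s) = mk f s :=
  (Quotient.sound (s := OQF.setoid) (Or.inr rfl : OQF.setoid.r (f, s) (-f, -s))).symm

/-- The attracting zero `x_a([f, s])`. -/
def attr (F : POQF) : OnePoint ℝ :=
  Quotient.lift OQF.attr (by
    rintro ⟨f, s⟩ ⟨f', s'⟩ (h | h)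
    · rw [h]
    · rw [h]
      rcases Int.units_eq_one_or s with rfl | rfl <;>
        simp [OQF.attr, QF.xPlus_neg, QF.xMinus_neg]) F

/-- The repelling zero `x_r([f, s])`. -/
def rep (F : POQF) : OnePoint ℝ :=
  Quotient.lift OQF.rep (by
    rintro ⟨f, s⟩ ⟨f', s'⟩ (h | h)
    · rw [h]
    · rw [h]
      rcases Int.units_eq_one_or s with rfl | rfl <;>
        simp [OQF.rep, QF.xPlus_neg, QF.xMinus_neg]) F

/-- The action of `SL₂(ℝ)` on projective oriented quadratic forms, `g.[f, s] = [g.f, s]`. -/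
instance slAction : MulAction SL2R POQF where
  smul g F := Quotient.map (fun F : OQF => ((g • F.1, F.2) : OQF)) (by
    rintro ⟨f, s⟩ ⟨f', s'⟩ (h | h)
    · exact Or.inl (by rw [h])
    · exact Or.inr (by rw [h, QF.smul_neg'])) F
  one_smul F := by
    induction F using Quotient.inductionOn with
    | _ F => exact congrArg (Quotient.mk OQF.setoid) (by simp)
  mul_smul g h F := by
    induction F using Quotient.inductionOn with
    | _ F => exact congrArg (Quotient.mk OQF.setoid) (by simp [mul_smul])

theorem sl_smul_mk (g : SL2R) (f : QF) (s : ℤˣ) : g • mk f s = mk (g • f) s := rfl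

/-- The permutation representation of `PSL₂(ℝ)` on projective oriented quadratic forms. -/
def permHom : PSL2R →* Equiv.Perm POQF :=
  QuotientGroup.lift (Subgroup.center SL2R) (MulAction.toPermHom SL2R POQF) (by
    intro A hA
    rw [MonoidHom.mem_ker]
    rcases center_eq_one_or_neg hA with rfl | rfl
    · exact map_one _
    · ext F
      induction F using Quotient.inductionOn with
      | _ F => exact congrArg (Quotient.mk OQF.setoid) (by simp [QF.neg_one_smul']))

instance pslAction : MulAction PSL2R POQF := MulAction.compHom _ permHom

theorem psl_smul_mk (g : SL2R) (f : QF) (s : ℤˣ) :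
    (g : PSL2R) • mk f s = mk (g • f) s := rfl

/-- The pair of zeros `φ₂(F) = (x_a(F), x_r(F))`. -/
def zeros (F : POQF) : OnePoint ℝ × OnePoint ℝ := (F.attr, F.rep)

/-- `F` satisfies `x_a(F) > 0 > x_r(F)`. -/
def IsReduced (F : POQF) : Prop := 0 < toOrd F.attr ∧ toOrd F.rep < 0

/-- The hyperbolic element `ψ₂(F)` of `PSL₂(ℝ)` attached to `F`. -/
def psi (F : POQF) : PSL2R :=
  Quotient.lift (fun F : OQF => (F.toSL : PSL2R)) (by
    rintro ⟨f, s⟩ ⟨f', s'⟩ (h | h)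
    · rw [h]
    · rw [h]
      have : OQF.toSL (-f, -s) = -OQF.toSL (f, s) := by
        apply Subtype.ext
        rw [Matrix.SpecialLinearGroup.coe_neg]
        ext i j
        fin_cases i <;> fin_cases j <;>
          simp [OQF.toSL, QF.neg_A, QF.neg_B, QF.neg_C, QF.neg_D] <;> ring
      simp only [this]
      exact (HeckeReduction.mk_neg _).symm) F

/-- For a hyperbolic matrix with rows `(a, b)`, `(c, d)`, the form `[c, d - a, -b, sgn(a + d)]`. -/
def ofSL (M : SL2R) (hM : (M : Matrix (Fin 2) (Fin 2) ℝ).IsHyperbolic) : POQF :=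
  mk { A := M 1 0
       B := M 1 1 - M 0 0
       C := -M 0 1
       indefinite := by
        unfold Matrix.IsHyperbolic at hM
        rw [Matrix.discr_fin_two, Matrix.trace_fin_two, Matrix.det_fin_two] at hM
        unfold discrim
        nlinarith [hM] }
    (if 0 < M 0 0 + M 1 1 then 1 else -1)

/-- The inverse map `ψ₂⁻¹ : [[a, b], [c, d]] ↦ [c, d - a, -b, sgn(a + d)]`, defined on hyperbolic
elements through a representative in `SL₂(ℝ)`; see `psiInv_mk` for the independence of the
representative. -/
def psiInv (g : {g : PSL2R // IsHyp g}) : POQF :=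
  ofSL (Quotient.out g.1) ((isHyp_mk _).1 (by rw [QuotientGroup.out_eq']; exact g.2))

theorem ofSL_neg (N : SL2R) (h1 : (N : Matrix (Fin 2) (Fin 2) ℝ).IsHyperbolic)
    (h2 : ((-N : SL2R) : Matrix (Fin 2) (Fin 2) ℝ).IsHyperbolic) : ofSL (-N) h2 = ofSL N h1 := by
  have h3 := h1
  unfold Matrix.IsHyperbolic at h3
  rw [Matrix.discr_fin_two, Matrix.trace_fin_two, Matrix.det_fin_two] at h3
  have hdet := N.det_coe
  rw [Matrix.det_fin_two] at hdet
  have htr : N 0 0 + N 1 1 ≠ 0 := by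
    intro h0
    rw [h0, hdet] at h3
    norm_num at h3
  unfold ofSL
  rw [← mk_neg]
  congr 1
  · ext <;> simp [QF.neg_A, QF.neg_B, QF.neg_C] <;> ring
  · simp only [Matrix.SpecialLinearGroup.coe_neg, Matrix.neg_apply]
    rcases lt_or_gt_of_ne htr with h | h
    · have h' : 0 < -N 0 0 + -N 1 1 := by linarith
      have h'' : ¬ 0 < N 0 0 + N 1 1 := by linarith
      simp [h', h'']
    · have h' : ¬ 0 < -N 0 0 + -N 1 1 := by linarith
      simp [h', h]

theorem psiInv_mk (M : SL2R) (hM : (M : Matrix (Fin 2) (Fin 2) ℝ).IsHyperbolic) :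
    psiInv ⟨(M : PSL2R), (isHyp_mk M).2 hM⟩ = ofSL M hM := by
  have h : ((Quotient.out (M : PSL2R) : SL2R) : PSL2R) = (M : PSL2R) := QuotientGroup.out_eq' _
  have key : ∀ (N : SL2R) (hN : (N : Matrix (Fin 2) (Fin 2) ℝ).IsHyperbolic),
      (N : PSL2R) = (M : PSL2R) → ofSL N hN = ofSL M hM := by
    intro N hN h
    rcases (mk_eq_mk_iff M N).1 h.symm with rfl | rfl
    · rfl
    · exact ofSL_neg M hM hN
  exact key _ _ h

end POQF

/-! ### Hecke triangle groups and their forms -/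

/-- `λ_q = 2 cos(π / q)`. -/
def lam (q : ℕ) : ℝ := 2 * Real.cos (Real.pi / q)

/-- The generator `S`, with rows `(0, 1)` and `(-1, 0)`. -/
def S : PSL2R := QuotientGroup.mk (⟨!![0, 1; -1, 0], by simp⟩ : SL2R)

/-- The generator `T_q`, with rows `(1, λ_q)` and `(0, 1)`. -/
def T (q : ℕ) : PSL2R := QuotientGroup.mk (⟨!![1, lam q; 0, 1], by simp⟩ : SL2R)

/-- The Hecke triangle group `Γ_q`. -/
def heckeGroup (q : ℕ) : Subgroup PSL2R := Subgroup.closure {S, T q}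

/-- The set of `Γ_q`-forms: those `F` for which `ψ₂(F)` is a hyperbolic element of `Γ_q`. -/
def gammaForms (q : ℕ) : Set POQF := {F | F.psi ∈ heckeGroup q ∧ IsHyp F.psi}

/-- `Γ_q`-equivalence of projective oriented quadratic forms. -/
def GammaEquiv (q : ℕ) (F F' : POQF) : Prop := ∃ g ∈ heckeGroup q, g • F = F'

/-- `n` is the level of the `Γ_q`-form `F`: the maximal `n` such that `ψ₂(F)` is an `n`-th power of
an element of `Γ_q`. -/
def IsLevel (q : ℕ) (F : POQF) (n : ℕ) : Prop :=
  IsGreatest {n : ℕ | 1 ≤ n ∧ ∃ h ∈ heckeGroup q, F.psi = h ^ n} n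

/-- `U = T S`. -/
def U (q : ℕ) : PSL2R := T q * S

/-- `g_k = (U^k S)⁻¹`. -/
def gElt (q k : ℕ) : PSL2R := (U q ^ k * S)⁻¹

/-- `x` lies in the interval `(g_k⁻¹.0, g_k⁻¹.∞)`. -/
def InInterval (q k : ℕ) (x : OnePoint ℝ) : Prop :=
  toOrd ((gElt q k)⁻¹ • ((0 : ℝ) : OnePoint ℝ)) < toOrd x ∧
    toOrd x < toOrd ((gElt q k)⁻¹ • (∞ : OnePoint ℝ))

open Classical in
/-- `interval(x)`: the `k ∈ {1, …, q - 1}` with `x ∈ (g_k⁻¹.0, g_k⁻¹.∞)` (these intervals are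
pairwise disjoint); undefined if `x` lies in none of these intervals. -/
def interval (q : ℕ) (x : OnePoint ℝ) : Part ℕ :=
  ⟨∃ k, 1 ≤ k ∧ k < q ∧ InInterval q k x, fun h => Nat.find h⟩

/-! ### The reduction algorithm -/

open Classical in
/-- `while cond do body`, as a partial function of the state: undefined if the loop does not
terminate or if a call of `body` is undefined. -/
def whileLoop {σ : Type} (cond : σ → Prop) (body : σ → Part σ) : σ → Part σ :=
  PFun.fix fun s => if cond s then (body s).map Sum.inr else Part.some (Sum.inl s)

/-- `repeat body until cond`. -/
def repeatUntil {σ : Type} (body : σ → Part σ) (cond : σ → Prop) (s : σ) : Part σ :=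
  (body s).bind (whileLoop (fun s => ¬ cond s) body)

/-- The variables of the algorithm; the indexed variables `F_j`, `(x_j, y_j)`, `h_j`, `a_j` are
arrays. -/
structure State where
  F : ℕ → POQF
  xy : ℕ → OnePoint ℝ × OnePoint ℝ
  h : ℕ → PSL2R
  a : ℕ → PSL2R
  j : ℕ
  m : ℕ
  p : ℕ
  n : ℕ

/-- The data returned by the algorithm. -/
structure Output where
  level : ℕ
  preperiod : List POQF
  period : List POQF
  element : PSL2R

/-- Initialization: `F_0 ← F`, `(x_0, y_0) ← φ₂(F_0)`, `h_0 ← id`, `j ← 0`. (All other entries are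
overwritten before they are read.) -/
def initState (F : POQF) : State where
  F := fun _ => F
  xy := fun _ => F.zeros
  h := fun _ => 1
  a := fun _ => 1
  j := 0
  m := 0
  p := 0
  n := 0

open Classical in
/-- If `x_0 < 0`, then `F_1 ← S.F_0`, `(x_1, y_1) ← (S.x_0, S.y_0)`, `h_1 ← S`, `j ← 1`. -/
def enforcePositive (s : State) : State :=
  if toOrd (s.xy 0).1 < 0 then
    { s with
      F := Function.update s.F 1 (S • s.F 0)
      xy := Function.update s.xy 1 (S • (s.xy 0).1, S • (s.xy 0).2)
      h := Function.update s.h 1 S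
      j := 1 }
  else s

/-- One pass of the preperiod loop: `k ← interval(x_j)`, `F_{j+1} ← g_k.F_j`,
`(x_{j+1}, y_{j+1}) ← g_k.(x_j, y_j)`, `h_{j+1} ← h_j g_k⁻¹`, `j ← j + 1`. -/
def preperiodBody (q : ℕ) (s : State) : Part State :=
  (interval q (s.xy s.j).1).map fun k =>
    { s with
      F := Function.update s.F (s.j + 1) (gElt q k • s.F s.j)
      xy := Function.update s.xy (s.j + 1) (gElt q k • s.xy s.j)
      h := Function.update s.h (s.j + 1) (s.h s.j * (gElt q k)⁻¹)
      j := s.j + 1 }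

/-- One pass of the period loop: `k ← interval(x_j)`, `F_{j+1} ← g_k.F_j`,
`(x_{j+1}, y_{j+1}) ← g_k.(x_j, y_j)`, `j ← j + 1`, `a_{j-m} ← a_{j-m-1} g_k⁻¹`. -/
def periodBody (q : ℕ) (s : State) : Part State :=
  (interval q (s.xy s.j).1).map fun k =>
    { s with
      F := Function.update s.F (s.j + 1) (gElt q k • s.F s.j)
      xy := Function.update s.xy (s.j + 1) (gElt q k • s.xy s.j)
      j := s.j + 1
      a := Function.update s.a (s.j + 1 - s.m) (s.a (s.j - s.m) * (gElt q k)⁻¹) }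

/-- The element `h_m a_p^n h_m⁻¹`. -/
def State.element (s : State) : PSL2R := s.h s.m * s.a s.p ^ s.n * (s.h s.m)⁻¹

/-- The test `ψ₂⁻¹(h_m a_p^n h_m⁻¹) = F`. -/
def State.test (F : POQF) (s : State) : Prop :=
  ∃ hg : IsHyp s.element, POQF.psiInv ⟨s.element, hg⟩ = F

/-- The reduction algorithm for the Hecke triangle group `Γ_q`, as a partial function of its input:
it is defined at `F` if and only if the computation started with `F` terminates, and its value is
then the returned output. -/
def reductionAlgorithm (q : ℕ) (F : POQF) : Part Output := do
  let s ← whileLoop (fun s : State => ¬ (s.F s.j).IsReduced) (preperiodBody q)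
    (enforcePositive (initState F))
  let s ← repeatUntil (periodBody q) (fun s : State => s.xy s.j = s.xy s.m)
    { s with m := s.j, a := Function.update s.a 0 1 }
  let s ← whileLoop (fun s : State => ¬ s.test F)
    (fun s => Part.some { s with n := s.n + 1 }) { s with p := s.j - s.m, n := 1 }
  return {
    level := s.n
    preperiod := (List.range (s.m + 1)).map s.F
    period := (List.range s.p).map fun i => s.F (s.m + 1 + i)
    element := s.element }

end

end HeckeReduction

/-!
The elements `V_k = g_k⁻¹ = U^k S`, `1 ≤ k < q`, are represented by matrices whose entries
`sin(j π / q) / sin(π / q)` are zero or at least one. Hence the same holds for every word in the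
`V_k`, and the sum of the entries of a word exceeds its length (`exists_isGrowing`). The words map
the positive half-line into itself and their inverses map the negative half-line into itself.

Because `V_k⁻¹ = S V_{q-k} S` and `V_j S V_k` is `V_{j+k}`, `S` or `V_{j+k-q}`, every element of the
Hecke group is a word in the `V_k`, the inverse of one, or such a word multiplied by `S` on one side
(`mem_heckeGroup_cases`). Two consequences carry the proof.

* Discreteness: a `Γ_q`-form `[A, B, C]` has `|A|, |C| ≥ 1` (`one_le_abs_coeff`). Its zeros are thus
  never `0` or `∞`, so no zero of a `Γ_q`-form is an endpoint of one of the intervals, and `interval`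
  is defined at every positive attracting zero. If a word `w` is such that both zeros of `w⁻¹ F` are
  positive, there is no cancellation in the coefficients of `F = w (w⁻¹ F)`, which bounds the length
  of `w` (`length_le_of_isPos`); therefore the preperiod is finite.

* Combinatorics of words: looking at the images of the half-lines shows that the hyperbolic element
  of a reduced form is a nonempty word `V_{k_1} ⋯ V_{k_r}`, that `k_1` is the interval of the
  attracting zero, and that a reduction step rotates the word cyclically. More generally, a word that
  maps one reduced form to another is read off from the reduction steps of the latter
  (`eq_itinerary_of_word_smul`). So reduction is periodic on reduced forms, equivalent reduced forms
  lie on one cycle (`exists_iterate_eq_of_smul_eq`), and the stabilizer of a reduced form in the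
  Hecke group consists of the powers of the element `a_p` of its period, which has infinite order.
  This identifies the level (`IsRed.isLevel`).

The zeros of a form are treated as the eigenlines of a trace-zero matrix, which makes their
equivariance a matter of matrix multiplication (`POQF.attr_smul`).
-/

namespace HeckeReduction

open Matrix OnePoint

noncomputable section

/-! ### Homogeneous coordinates on `P¹(ℝ)` -/

/-- The point of `P¹(ℝ)` with homogeneous coordinates `(u : v)`; only meaningful for
`(u, v) ≠ (0, 0)`. -/
def pt (u v : ℝ) : OnePoint ℝ := if v = 0 then ∞ else ((u / v : ℝ) : OnePoint ℝ)

theorem pt_one (r : ℝ) : pt r 1 = (r : OnePoint ℝ) := by simp [pt]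

theorem pt_zero (u : ℝ) : pt u 0 = ∞ := by simp [pt]

theorem exists_pt (x : OnePoint ℝ) : ∃ u v : ℝ, (u ≠ 0 ∨ v ≠ 0) ∧ x = pt u v := by
  induction x using OnePoint.rec with
  | infty => exact ⟨1, 0, by simp, (pt_zero 1).symm⟩
  | coe x => exact ⟨x, 1, by simp, (pt_one x).symm⟩

theorem pt_eq_pt_iff {u v u' v' : ℝ} (h : u ≠ 0 ∨ v ≠ 0) (h' : u' ≠ 0 ∨ v' ≠ 0) :
    pt u v = pt u' v' ↔ u * v' = u' * v := by
  unfold pt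
  split_ifs with h1 h2 h2
  · simp [h1, h2]
  · subst h1
    have hu : u ≠ 0 := by simpa using h
    simp [h2, hu]
  · subst h2
    have hu : u' ≠ 0 := by simpa using h'
    simp [h1, hu]
  · rw [OnePoint.coe_eq_coe, div_eq_div_iff h1 h2]

theorem mk_smul_coe (g : SL2R) (x : OnePoint ℝ) :
    (g : PSL2R) • x = Matrix.SpecialLinearGroup.toGL g • x := rfl

theorem mulVec_ne_zero (g : SL2R) {u v : ℝ} (h : u ≠ 0 ∨ v ≠ 0) :
    g 0 0 * u + g 0 1 * v ≠ 0 ∨ g 1 0 * u + g 1 1 * v ≠ 0 := by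
  have hdet := g.det_coe
  rw [Matrix.det_fin_two] at hdet
  by_contra! hc
  have hu : u = 0 := by linear_combination g 1 1 * hc.1 - g 0 1 * hc.2 - u * hdet
  have hv : v = 0 := by linear_combination g 0 0 * hc.2 - g 1 0 * hc.1 - v * hdet
  simp [hu, hv] at h

theorem mk_smul_pt (g : SL2R) {u v : ℝ} (h : u ≠ 0 ∨ v ≠ 0) :
    (g : PSL2R) • pt u v = pt (g 0 0 * u + g 0 1 * v) (g 1 0 * u + g 1 1 * v) := by
  rw [mk_smul_coe]
  by_cases hv : v = 0
  · subst hv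
    have hu : u ≠ 0 := by simpa using h
    rw [pt_zero, OnePoint.smul_infty_eq_ite]
    by_cases hc : g 1 0 = 0
    · simp [hc, pt]
    · simpa [hc, pt, hu] using (mul_div_mul_right _ _ hu).symm
  · have h1 : pt u v = ((u / v : ℝ) : OnePoint ℝ) := by simp [pt, hv]
    rw [h1, OnePoint.smul_some_eq_ite]
    have h2 : g 1 0 * (u / v) + g 1 1 = (g 1 0 * u + g 1 1 * v) / v := by field_simp
    have h3 : g 0 0 * (u / v) + g 0 1 = (g 0 0 * u + g 0 1 * v) / v := by field_simp
    simp only [Matrix.SpecialLinearGroup.toGL, pt]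
    simp only [MonoidHom.coe_mk, OneHom.coe_mk]
    change (if g 1 0 * (u / v) + g 1 1 = 0 then ∞ else
      (((g 0 0 * (u / v) + g 0 1) / (g 1 0 * (u / v) + g 1 1) : ℝ) : OnePoint ℝ)) = _
    rw [h2, h3]
    by_cases hc : g 1 0 * u + g 1 1 * v = 0
    · simp [hc]
    · rw [div_div_div_cancel_right₀ hv]
      simp [hc, hv]

/-- `x` is a positive real number. -/
def IsPos (x : OnePoint ℝ) : Prop := ∃ r : ℝ, 0 < r ∧ x = r

/-- `x` is a negative real number. -/
def IsNeg (x : OnePoint ℝ) : Prop := ∃ r : ℝ, r < 0 ∧ x = r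

theorem isPos_pt {u v : ℝ} : IsPos (pt u v) ↔ 0 < u * v := by
  unfold IsPos pt
  split_ifs with h
  · simp [h]
  · have : 0 < u / v ↔ 0 < u * v := by
      rw [div_pos_iff, mul_pos_iff]
    rw [← this]
    constructor
    · rintro ⟨r, hr, h⟩
      rwa [OnePoint.coe_eq_coe.1 h]
    · exact fun h => ⟨_, h, rfl⟩

theorem isNeg_pt {u v : ℝ} : IsNeg (pt u v) ↔ u * v < 0 := by
  unfold IsNeg pt
  split_ifs with h
  · simp [h]
  · have : u / v < 0 ↔ u * v < 0 := by
      rw [div_neg_iff, mul_neg_iff]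
    rw [← this]
    constructor
    · rintro ⟨r, hr, h⟩
      rwa [OnePoint.coe_eq_coe.1 h]
    · exact fun h => ⟨_, h, rfl⟩

theorem toOrd_coe (r : ℝ) : toOrd (r : OnePoint ℝ) = (r : WithTop ℝ) := rfl

theorem toOrd_infty : toOrd ∞ = ⊤ := rfl

theorem toOrd_neg_iff {x : OnePoint ℝ} : toOrd x < 0 ↔ IsNeg x := by
  induction x using OnePoint.rec with
  | infty => simp [toOrd_infty, IsNeg]
  | coe x =>
    rw [toOrd_coe, ← WithTop.coe_zero, WithTop.coe_lt_coe]
    simp [IsNeg]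

theorem toOrd_pos_iff {x : OnePoint ℝ} : 0 < toOrd x ↔ IsPos x ∨ x = ∞ := by
  induction x using OnePoint.rec with
  | infty => simp [toOrd_infty]
  | coe x =>
    rw [toOrd_coe, ← WithTop.coe_zero, WithTop.coe_lt_coe]
    simp [IsPos]

theorem IsPos.not_isNeg {x : OnePoint ℝ} (h : IsPos x) : ¬ IsNeg x := by
  rintro ⟨r, hr, rfl⟩
  obtain ⟨s, hs, h⟩ := h
  rw [OnePoint.coe_eq_coe] at h
  linarith

/-! ### Zeros of forms as eigenlines -/

/-- `(u, v)` is a nonzero eigenvector, with eigenvalue `s √D`, of the trace-zero matrix with rows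
`(-B, -2 C)` and `(2 A, B)`. -/
structure IsEigen (f : QF) (s : ℝ) (u v : ℝ) : Prop where
  ne : u ≠ 0 ∨ v ≠ 0
  fst : -f.B * u - 2 * f.C * v = s * √f.D * u
  snd : 2 * f.A * u + f.B * v = s * √f.D * v

theorem QF.sqrt_D_pos (f : QF) : 0 < √f.D := Real.sqrt_pos.2 f.indefinite

theorem QF.sqrt_D_sq (f : QF) : √f.D ^ 2 = f.B ^ 2 - 4 * f.A * f.C :=
  Real.sq_sqrt f.indefinite.le

theorem QF.B_ne_zero {f : QF} (hA : f.A = 0) : f.B ≠ 0 := by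
  intro hB
  have := f.indefinite
  simp [discrim, hA, hB] at this

theorem QF.exists_isEigen_xPlus (f : QF) : ∃ u v, IsEigen f 1 u v ∧ f.xPlus = pt u v := by
  have hsq := f.sqrt_D_sq
  have hpos := f.sqrt_D_pos
  unfold QF.xPlus
  split_ifs with hA hB
  · have hs : √f.D = f.B := by
      rw [hA] at hsq
      nlinarith
    exact ⟨-f.C, f.B, ⟨Or.inr hB.ne', by rw [hs]; ring, by rw [hs, hA]; ring⟩, by
      simp [pt, hB.ne']⟩
  · have hB' : f.B < 0 := lt_of_le_of_ne (not_lt.1 hB) (QF.B_ne_zero hA)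
    have hs : √f.D = -f.B := by
      rw [hA] at hsq
      nlinarith
    exact ⟨1, 0, ⟨by simp, by rw [hs]; ring, by rw [hA]; ring⟩, by simp [pt]⟩
  · refine ⟨-f.B + √f.D, 2 * f.A, ⟨Or.inr (by simpa using hA), ?_, by ring⟩, by simp [pt, hA]⟩
    linear_combination -hsq

theorem QF.exists_isEigen_xMinus (f : QF) : ∃ u v, IsEigen f (-1) u v ∧ f.xMinus = pt u v := by
  obtain ⟨u, v, h, hx⟩ := (-f).exists_isEigen_xPlus
  refine ⟨u, v, ⟨h.ne, ?_, ?_⟩, by rw [← QF.xPlus_neg, hx]⟩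
  · have := h.fst
    rw [QF.neg_B, QF.neg_C, QF.neg_D] at this
    linear_combination -this
  · have := h.snd
    rw [QF.neg_A, QF.neg_B, QF.neg_D] at this
    linear_combination -this

/-- The eigenline for a given eigenvalue is a single point of `P¹(ℝ)`. -/
theorem IsEigen.unique {f : QF} {s u v u' v' : ℝ} (hs : s ^ 2 = 1) (h : IsEigen f s u v)
    (h' : IsEigen f s u' v') : pt u v = pt u' v' := by
  rw [pt_eq_pt_iff h.ne h'.ne]
  have hpos := f.sqrt_D_pos
  -- If the two vectors were independent, the matrix would be the scalar `s √D`, of nonzero trace.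
  by_contra hne
  have hne : u * v' - u' * v ≠ 0 := sub_ne_zero.2 hne
  have h1 : (u * v' - u' * v) * (-f.B - s * √f.D) = 0 := by
    linear_combination v' * h.fst - v * h'.fst
  have h2 : (u * v' - u' * v) * (f.B - s * √f.D) = 0 := by
    linear_combination u * h'.snd - u' * h.snd
  have h3 := (mul_eq_zero.1 h1).resolve_left hne
  have h4 := (mul_eq_zero.1 h2).resolve_left hne
  have h5 : s * √f.D = 0 := by linarith
  rcases mul_eq_zero.1 h5 with h5 | h5
  · simp [h5] at hs
  · exact hpos.ne' h5

theorem IsEigen.indep {f : QF} {u v u' v' : ℝ} (h : IsEigen f 1 u v)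
    (h' : IsEigen f (-1) u' v') : u * v' - u' * v ≠ 0 := by
  have hpos := f.sqrt_D_pos
  intro h0
  have h1 : √f.D * (u * u') = 0 := by
    linear_combination (-u' / 2) * h.fst + (u / 2) * h'.fst + f.C * h0
  have h2 : √f.D * (v * v') = 0 := by
    linear_combination (-v' / 2) * h.snd + (v / 2) * h'.snd + f.A * h0
  have h1 := (mul_eq_zero.1 h1).resolve_left hpos.ne'
  have h2 := (mul_eq_zero.1 h2).resolve_left hpos.ne'
  have n1 := h.ne
  have n2 := h'.ne
  rcases mul_eq_zero.1 h1 with rfl | rfl <;> rcases mul_eq_zero.1 h2 with rfl | rfl <;> simp_all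

theorem QF.smul_D (g : SL2R) (f : QF) : (g • f).D = f.D := by
  have hdet := g.det_coe
  rw [Matrix.det_fin_two] at hdet
  simp only [QF.D, discrim, QF.smul_A, QF.smul_B, QF.smul_C]
  linear_combination (f.B ^ 2 - 4 * f.A * f.C) *
    (g 0 0 * g 1 1 - g 0 1 * g 1 0 + 1) * hdet

theorem IsEigen.smul {f : QF} {s u v : ℝ} (h : IsEigen f s u v) (g : SL2R) :
    IsEigen (g • f) s (g 0 0 * u + g 0 1 * v) (g 1 0 * u + g 1 1 * v) := by
  have hdet := g.det_coe
  rw [Matrix.det_fin_two] at hdet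
  obtain ⟨h0, h1, h2⟩ := h
  refine ⟨mulVec_ne_zero g h0, ?_, ?_⟩
  · rw [QF.smul_D, QF.smul_B, QF.smul_C]
    linear_combination g 0 0 * h1 + g 0 1 * h2 +
      (g 0 0 * (-f.B * u - 2 * f.C * v) + g 0 1 * (2 * f.A * u + f.B * v)) * hdet
  · rw [QF.smul_D, QF.smul_A, QF.smul_B]
    linear_combination g 1 0 * h1 + g 1 1 * h2 +
      (g 1 0 * (-f.B * u - 2 * f.C * v) + g 1 1 * (2 * f.A * u + f.B * v)) * hdet

namespace POQF

theorem exists_eq_mk_one (F : POQF) : ∃ f : QF, F = mk f 1 := by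
  induction F using Quotient.inductionOn with
  | _ F =>
    obtain ⟨f, s⟩ := F
    rcases Int.units_eq_one_or s with rfl | rfl
    · exact ⟨f, rfl⟩
    · exact ⟨-f, by rw [← mk_neg, QF.neg_neg']; rfl⟩

theorem attr_mk_one (f : QF) : (mk f 1).attr = f.xPlus := rfl

theorem rep_mk_one (f : QF) : (mk f 1).rep = f.xMinus := rfl

theorem psi_mk (f : QF) (s : ℤˣ) : (mk f s).psi = (OQF.toSL (f, s) : PSL2R) := rfl

theorem attr_eq_pt {f : QF} {u v : ℝ} (h : IsEigen f 1 u v) : (mk f 1).attr = pt u v := by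
  obtain ⟨u', v', h', hx⟩ := f.exists_isEigen_xPlus
  rw [attr_mk_one, hx]
  exact h'.unique (by norm_num) h

theorem rep_eq_pt {f : QF} {u v : ℝ} (h : IsEigen f (-1) u v) : (mk f 1).rep = pt u v := by
  obtain ⟨u', v', h', hx⟩ := f.exists_isEigen_xMinus
  rw [rep_mk_one, hx]
  exact h'.unique (by norm_num) h

/-- If `(u, v)` is an eigenvector of the trace-zero matrix of `f`, then `g (u, v)` is one for
`g f`. -/
theorem attr_smul (g : PSL2R) (F : POQF) : (g • F).attr = g • F.attr := by
  induction g using QuotientGroup.induction_on with | _ g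
  obtain ⟨f, rfl⟩ := F.exists_eq_mk_one
  obtain ⟨u, v, h, hx⟩ := f.exists_isEigen_xPlus
  rw [psl_smul_mk, attr_eq_pt (h.smul g), attr_mk_one, hx, mk_smul_pt g h.ne]

theorem rep_smul (g : PSL2R) (F : POQF) : (g • F).rep = g • F.rep := by
  induction g using QuotientGroup.induction_on with | _ g
  obtain ⟨f, rfl⟩ := F.exists_eq_mk_one
  obtain ⟨u, v, h, hx⟩ := f.exists_isEigen_xMinus
  rw [psl_smul_mk, rep_eq_pt (h.smul g), rep_mk_one, hx, mk_smul_pt g h.ne]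

theorem zeros_smul (g : PSL2R) (F : POQF) : (g • F).zeros = g • F.zeros := by
  simp [zeros, attr_smul, rep_smul]

/-- A form is determined by its pair of zeros among the forms of its orbit: the discriminant is
constant on orbits, so the eigenlines also determine the eigenvalues. -/
theorem smul_eq_of_zeros_eq {g : PSL2R} {F : POQF} (h : (g • F).zeros = F.zeros) : g • F = F := by
  induction g using QuotientGroup.induction_on with | _ g
  obtain ⟨f, rfl⟩ := F.exists_eq_mk_one
  have hD := QF.smul_D g f
  rw [psl_smul_mk] at h ⊢
  set f' := g • f
  obtain ⟨ha, hr⟩ := Prod.mk.inj h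
  obtain ⟨u, v, e, hx⟩ := f.exists_isEigen_xPlus
  obtain ⟨u', v', e', hx'⟩ := f.exists_isEigen_xMinus
  obtain ⟨a, b, d, hy⟩ := f'.exists_isEigen_xPlus
  obtain ⟨a', b', d', hy'⟩ := f'.exists_isEigen_xMinus
  rw [attr_mk_one, attr_mk_one, hx, hy, pt_eq_pt_iff d.ne e.ne] at ha
  rw [rep_mk_one, rep_mk_one, hx', hy', pt_eq_pt_iff d'.ne e'.ne] at hr
  have transfer : ∀ {s a b u v : ℝ}, IsEigen f' s a b → (u ≠ 0 ∨ v ≠ 0) → a * v = u * b →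
      IsEigen f' s u v := by
    rintro s a b u v ⟨h0, h1, h2⟩ hn hab
    rcases h0 with h0 | h0
    · have hu : u ≠ 0 := by
        rintro rfl
        simp [h0] at hab
        simp [hab] at hn
      refine ⟨hn, mul_left_cancel₀ h0 ?_, mul_left_cancel₀ h0 ?_⟩
      · linear_combination u * h1 - 2 * f'.C * hab
      · linear_combination u * h2 + (f'.B - s * √f'.D) * hab
    · refine ⟨hn, mul_left_cancel₀ h0 ?_, mul_left_cancel₀ h0 ?_⟩
      · linear_combination v * h1 + (f'.B + s * √f'.D) * hab
      · linear_combination v * h2 - 2 * f'.A * hab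
  have d := transfer d e.ne ha
  have d' := transfer d' e'.ne hr
  have hne := e.indep e'
  have d1 := d.fst; have d2 := d.snd; have d3 := d'.fst; have d4 := d'.snd
  rw [hD] at d1 d2 d3 d4
  have cancel : ∀ {x y : ℝ}, (u * v' - u' * v) * (x - y) = 0 → x = y := fun h =>
    sub_eq_zero.1 ((mul_eq_zero.1 h).resolve_left hne)
  have hA : f'.A = f.A := cancel (by
    linear_combination (v' / 2) * (d2 - e.snd) - (v / 2) * (d4 - e'.snd))
  have hB : f'.B = f.B := cancel (by
    linear_combination (-v') * (d1 - e.fst) + v * (d3 - e'.fst))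
  have hC : f'.C = f.C := cancel (by
    linear_combination (u' / 2) * (d1 - e.fst) - (u / 2) * (d3 - e'.fst))
  rw [QF.ext hA hB hC]

/-! ### The bijection between forms and hyperbolic elements -/

theorem isHyperbolic_toSL (F : OQF) :
    (F.toSL : Matrix (Fin 2) (Fin 2) ℝ).IsHyperbolic := by
  have hdet := F.toSL.det_coe
  have hD : 0 < F.1.D := F.1.indefinite
  have hs : ((F.2 : ℤ) : ℝ) ^ 2 = 1 := by
    rcases Int.units_eq_one_or F.2 with h | h <;> simp [h]
  have hsq : √(F.1.D + 4) ^ 2 = F.1.D + 4 := Real.sq_sqrt (by linarith)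
  unfold Matrix.IsHyperbolic
  rw [Matrix.discr_fin_two, hdet, Matrix.trace_fin_two]
  simp only [OQF.toSL, Matrix.of_apply, Matrix.cons_val]
  have : ((-F.1.B + ((F.2 : ℤ) : ℝ) * √(F.1.D + 4)) / 2 +
      (F.1.B + ((F.2 : ℤ) : ℝ) * √(F.1.D + 4)) / 2) ^ 2 = F.1.D + 4 := by
    linear_combination hs * √(F.1.D + 4) ^ 2 + hsq
  linarith

theorem isHyp_psi (F : POQF) : IsHyp F.psi := by
  induction F using Quotient.inductionOn with
  | _ F => exact (isHyp_mk _).2 (isHyperbolic_toSL F)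

theorem psiInv_psi (F : POQF) (h : IsHyp F.psi) : psiInv ⟨F.psi, h⟩ = F := by
  obtain ⟨f, rfl⟩ := F.exists_eq_mk_one
  refine (psiInv_mk (OQF.toSL (f, 1)) (isHyperbolic_toSL _)).trans ?_
  have hD : 0 < f.D := f.indefinite
  have hs : 0 < √(f.D + 4) := Real.sqrt_pos.2 (by linarith)
  unfold ofSL
  congr 1
  · ext <;> simp [OQF.toSL]
    ring
  · rw [if_pos]
    simp [OQF.toSL]
    linarith

theorem psi_ofSL (M : SL2R) (hM : (M : Matrix (Fin 2) (Fin 2) ℝ).IsHyperbolic) :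
    (ofSL M hM).psi = M := by
  have hdet := M.det_coe
  rw [Matrix.det_fin_two] at hdet
  have hM' := hM
  unfold Matrix.IsHyperbolic at hM'
  rw [Matrix.discr_fin_two, Matrix.trace_fin_two, Matrix.det_fin_two] at hM'
  unfold ofSL
  rw [psi_mk]
  congr 1
  apply Subtype.ext
  set f : QF := { A := M 1 0, B := M 1 1 - M 0 0, C := -M 0 1, indefinite := _ } with hf
  have hD : f.D + 4 = (M 0 0 + M 1 1) ^ 2 := by
    simp only [hf, QF.D, discrim]
    linear_combination -4 * hdet
  have key : (((if 0 < M 0 0 + M 1 1 then 1 else -1 : ℤˣ) : ℤ) : ℝ) * √(f.D + 4)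
      = M 0 0 + M 1 1 := by
    rw [hD, Real.sqrt_sq_eq_abs]
    split_ifs with h
    · simp [abs_of_pos h]
    · simp [abs_of_nonpos (not_lt.1 h)]
  simp only [OQF.toSL]
  rw [key]
  ext i j
  fin_cases i <;> fin_cases j <;> simp [hf]
  all_goals ring

theorem psi_psiInv (g : PSL2R) (h : IsHyp g) : (psiInv ⟨g, h⟩).psi = g := by
  induction g using QuotientGroup.induction_on with | _ g
  have := psi_ofSL g ((isHyp_mk _).1 h)
  rwa [← psiInv_mk] at this

theorem psi_injective : Function.Injective psi := by
  intro F F' h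
  rw [← psiInv_psi F F.isHyp_psi, ← psiInv_psi F' F'.isHyp_psi]
  congr 1
  exact Subtype.ext h

theorem psi_smul (g : PSL2R) (F : POQF) : (g • F).psi = g * F.psi * g⁻¹ := by
  induction g using QuotientGroup.induction_on with | _ g
  obtain ⟨f, rfl⟩ := F.exists_eq_mk_one
  have hdet := g.det_coe
  rw [Matrix.det_fin_two] at hdet
  rw [psl_smul_mk, psi_mk, psi_mk, eq_mul_inv_iff_mul_eq, ← QuotientGroup.mk_mul,
    ← QuotientGroup.mk_mul]
  congr 1
  apply Subtype.ext
  rw [Matrix.SpecialLinearGroup.coe_mul, Matrix.SpecialLinearGroup.coe_mul]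
  simp only [OQF.toSL, QF.smul_D, QF.smul_A, QF.smul_B, QF.smul_C]
  ext i j
  fin_cases i <;> fin_cases j <;>
    simp only [Matrix.mul_apply, Fin.sum_univ_two, Fin.zero_eta, Fin.mk_one, Matrix.of_apply,
      Matrix.cons_val, Units.val_one, Int.cast_one, one_mul]
  · linear_combination (-g 0 0 * f.B / 2 + g 0 1 * f.A) * hdet
  · linear_combination (-g 0 0 * f.C + g 0 1 * f.B / 2) * hdet
  · linear_combination (-g 1 0 * f.B / 2 + g 1 1 * f.A) * hdet
  · linear_combination (-g 1 0 * f.C + g 1 1 * f.B / 2) * hdet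

theorem smul_eq_self_iff {g : PSL2R} {F : POQF} : g • F = F ↔ g * F.psi = F.psi * g := by
  rw [← psi_injective.eq_iff, psi_smul, mul_inv_eq_iff_eq_mul]

theorem psi_smul_self (F : POQF) : F.psi • F = F := smul_eq_self_iff.2 rfl

theorem psiInv_eq_iff {g : PSL2R} {F : POQF} :
    (∃ h : IsHyp g, psiInv ⟨g, h⟩ = F) ↔ g = F.psi := by
  constructor
  · rintro ⟨h, rfl⟩
    exact (psi_psiInv g h).symm
  · rintro rfl
    exact ⟨F.isHyp_psi, psiInv_psi F _⟩

end POQF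


/-! ### The generators of the positive monoid -/

/-- `sin(x π / q) / sin(π / q)`; for integral `x` these numbers are the entries of the elements
`U^k S`. -/
def sn (q : ℕ) (x : ℝ) : ℝ := Real.sin (x * (Real.pi / q)) / Real.sin (Real.pi / q)

/-- The element `V_k = U^k S = g_k⁻¹`. -/
def V (q k : ℕ) : PSL2R := U q ^ k * S

theorem gElt_inv (q k : ℕ) : (gElt q k)⁻¹ = V q k := inv_inv _

section sn

variable {q : ℕ}

theorem sin_pi_div_pos (hq : 3 ≤ q) : 0 < Real.sin (Real.pi / q) := by
  have h3 : (3 : ℝ) ≤ q := by exact_mod_cast hq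
  apply Real.sin_pos_of_pos_of_lt_pi
  · have := Real.pi_pos
    positivity
  · rw [div_lt_iff₀ (by linarith)]
    nlinarith [Real.pi_pos]

theorem sn_zero : sn q 0 = 0 := by simp [sn]

theorem sn_one (hq : 3 ≤ q) : sn q 1 = 1 := by
  simp [sn, div_self (sin_pi_div_pos hq).ne']

theorem sn_self (hq : 3 ≤ q) : sn q q = 0 := by
  have : (q : ℝ) ≠ 0 := by
    have : q ≠ 0 := by omega
    exact_mod_cast this
  unfold sn
  rw [mul_div_cancel₀ _ this, Real.sin_pi, zero_div]

theorem sn_rec (x : ℝ) : sn q (x + 1) = lam q * sn q x - sn q (x - 1) := by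
  unfold sn lam
  rw [add_mul, sub_mul, one_mul, Real.sin_add, Real.sin_sub]
  ring

theorem sn_sq (hq : 3 ≤ q) (x : ℝ) : sn q x * sn q x - sn q (x + 1) * sn q (x - 1) = 1 := by
  have h := (sin_pi_div_pos hq).ne'
  unfold sn
  rw [add_mul, sub_mul, one_mul, Real.sin_add, Real.sin_sub]
  set a := x * (Real.pi / q)
  set b := Real.pi / (q : ℝ)
  have h1 := Real.sin_sq_add_cos_sq a
  have h2 := Real.sin_sq_add_cos_sq b
  field_simp
  linear_combination (Real.sin b) ^ 2 * h1 - (Real.sin a) ^ 2 * h2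

/-- The function `x ↦ sin(x π / q)` is symmetric about `q / 2` and increasing on `[0, q / 2]`. -/
theorem one_le_sn (hq : 3 ≤ q) {x : ℝ} (h1 : 1 ≤ x) (h2 : x ≤ q - 1) : 1 ≤ sn q x := by
  have hs := sin_pi_div_pos hq
  have hq0 : (0 : ℝ) < q := by
    have : 0 < q := by omega
    exact_mod_cast this
  have hpi := Real.pi_pos
  have hqpi : (q : ℝ) * (Real.pi / q) = Real.pi := mul_div_cancel₀ _ hq0.ne'
  have hb : 0 < Real.pi / q := by positivity
  unfold sn
  rw [le_div_iff₀ hs, one_mul]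
  rcases le_total (x * (Real.pi / q)) (Real.pi / 2) with h | h
  · apply Real.sin_le_sin_of_le_of_le_pi_div_two
    · linarith
    · exact h
    · nlinarith
  · rw [← Real.sin_pi_sub (x * (Real.pi / q))]
    apply Real.sin_le_sin_of_le_of_le_pi_div_two
    · linarith
    · linarith
    · nlinarith

theorem sn_eq_zero_or_one_le (hq : 3 ≤ q) {k : ℕ} (hk : k ≤ q) : sn q k = 0 ∨ 1 ≤ sn q k := by
  rcases Nat.eq_zero_or_pos k with rfl | h0
  · left
    simpa using sn_zero
  rcases hk.eq_or_lt with rfl | h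
  · exact Or.inl (sn_self hq)
  · right
    apply one_le_sn hq
    · exact_mod_cast h0
    · have : ((k + 1 : ℕ) : ℝ) ≤ q := by exact_mod_cast h
      push_cast at this
      linarith

theorem one_le_sn_nat (hq : 3 ≤ q) {k : ℕ} (hk : 1 ≤ k) (hkq : k < q) : 1 ≤ sn q k := by
  apply one_le_sn hq
  · exact_mod_cast hk
  · have : ((k + 1 : ℕ) : ℝ) ≤ q := by exact_mod_cast hkq
    push_cast at this
    linarith

end sn

variable {q : ℕ}

theorem sl_mul_apply (X Y : SL2R) (i j : Fin 2) :
    (X * Y) i j = X i 0 * Y 0 j + X i 1 * Y 1 j := by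
  rw [Matrix.SpecialLinearGroup.coe_mul, Matrix.mul_apply, Fin.sum_univ_two]

/-- The representative of `S` in `SL₂(ℝ)`. -/
def Smat : SL2R := ⟨!![0, 1; -1, 0], by simp⟩

/-- The representative of `T` in `SL₂(ℝ)`. -/
def Tmat (q : ℕ) : SL2R := ⟨!![1, lam q; 0, 1], by simp⟩

@[simp] theorem coe_Smat : (Smat : Matrix (Fin 2) (Fin 2) ℝ) = !![0, 1; -1, 0] := rfl

@[simp] theorem coe_Tmat : (Tmat q : Matrix (Fin 2) (Fin 2) ℝ) = !![1, lam q; 0, 1] := rfl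

theorem mk_Smat : (Smat : PSL2R) = S := rfl

theorem mk_Tmat : (Tmat q : PSL2R) = T q := rfl

/-- The representative of `V_k` in `SL₂(ℝ)`. -/
def Vmat (hq : 3 ≤ q) (k : ℕ) : SL2R :=
  ⟨!![sn q k, sn q (k + 1); sn q (k - 1), sn q k], by
    rw [Matrix.det_fin_two_of]
    exact sn_sq hq k⟩

@[simp] theorem coe_Vmat (hq : 3 ≤ q) (k : ℕ) : (Vmat hq k : Matrix (Fin 2) (Fin 2) ℝ) =
    !![sn q k, sn q (k + 1); sn q (k - 1), sn q k] := rfl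

theorem mk_Vmat (hq : 3 ≤ q) (k : ℕ) : (Vmat hq k : PSL2R) = V q k := by
  induction k with
  | zero =>
    have h1 : sn q (-1) = -1 := by
      have := sn_rec (q := q) 0
      rw [zero_add, sn_one hq, sn_zero, zero_sub] at this
      linarith
    unfold V
    rw [pow_zero, one_mul, ← mk_Smat]
    congr 1
    apply Subtype.ext
    ext i j
    fin_cases i <;> fin_cases j <;> simp [sn_zero, sn_one hq, h1]
  | succ k ih =>
    have h : V q (k + 1) = U q * V q k := by
      unfold V
      rw [pow_succ', mul_assoc]
    rw [h, ← ih]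
    unfold U
    rw [← mk_Tmat, ← mk_Smat, ← QuotientGroup.mk_mul, ← QuotientGroup.mk_mul, mk_eq_mk_iff]
    right
    apply Subtype.ext
    have r1 := sn_rec (q := q) k
    have r2 := sn_rec (q := q) (k + 1)
    rw [add_sub_cancel_right] at r2
    ext i j
    fin_cases i <;> fin_cases j <;> simp [Matrix.mul_apply, Fin.sum_univ_two, r2] <;>
      linarith

theorem S_mul_S : S * S = 1 := by
  rw [← mk_Smat, ← QuotientGroup.mk_mul, ← QuotientGroup.mk_one, mk_eq_mk_iff]
  right
  apply Subtype.ext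
  ext i j
  fin_cases i <;> fin_cases j <;> simp

theorem S_mul_S_mul (g : PSL2R) : S * (S * g) = g := by rw [← mul_assoc, S_mul_S, one_mul]

theorem S_inv : S⁻¹ = S := inv_eq_of_mul_eq_one_left S_mul_S

theorem V_mul_S (k : ℕ) : V q k * S = U q ^ k := by
  unfold V
  rw [mul_assoc, S_mul_S, mul_one]

theorem U_pow (hq : 3 ≤ q) : U q ^ q = 1 := by
  have h : V q q = S := by
    rw [← mk_Vmat hq, ← mk_Smat, mk_eq_mk_iff]
    right
    have h0 := sn_self hq
    have h1 := sn_sq hq q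
    have h2 := sn_rec (q := q) q
    have h3 : sn q (q - 1 : ℝ) = 1 := by
      have : ((q - 1 : ℕ) : ℝ) = q - 1 := by
        rw [Nat.cast_sub (by omega), Nat.cast_one]
      have h4 := one_le_sn_nat hq (k := q - 1) (by omega) (by omega)
      rw [this] at h4
      rw [h0] at h1 h2
      nlinarith
    have h4 : sn q (q + 1 : ℝ) = -1 := by
      rw [h2, h0, h3]
      ring
    apply Subtype.ext
    ext i j
    fin_cases i <;> fin_cases j <;> simp [h0, h3, h4]
  rw [← V_mul_S, h, S_mul_S]

theorem V_one : V q 1 = T q := by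
  unfold V U
  rw [pow_one, mul_assoc, S_mul_S, mul_one]

theorem V_mul_S_mul_V (j k : ℕ) : V q j * S * V q k = V q (j + k) := by
  rw [V_mul_S]
  unfold V
  rw [pow_add, mul_assoc]

theorem V_self (hq : 3 ≤ q) : V q q = S := by
  unfold V
  rw [U_pow hq, one_mul]

theorem V_add_self (hq : 3 ≤ q) (k : ℕ) : V q (q + k) = V q k := by
  unfold V
  rw [pow_add, U_pow hq, one_mul]

theorem V_inv (hq : 3 ≤ q) {k : ℕ} (hk : k ≤ q) : (V q k)⁻¹ = S * V q (q - k) * S := by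
  apply inv_eq_of_mul_eq_one_right
  rw [← mul_assoc, ← mul_assoc, V_mul_S_mul_V, Nat.add_sub_cancel' hk, V_self hq, S_mul_S]

/-! ### Words in the generators -/

/-- The element `V_{k_1} ⋯ V_{k_r}` for the list `k_1, …, k_r`. -/
def word (q : ℕ) (l : List ℕ) : PSL2R := (l.map (V q)).prod

/-- All letters of the word are indices of the intervals, i.e. lie in `{1, …, q - 1}`. -/
def IsWord (q : ℕ) (l : List ℕ) : Prop := ∀ k ∈ l, 1 ≤ k ∧ k < q

@[simp] theorem word_nil : word q [] = 1 := rfl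

@[simp] theorem word_cons (k : ℕ) (l : List ℕ) : word q (k :: l) = V q k * word q l := by
  simp [word]

theorem word_append (l l' : List ℕ) : word q (l ++ l') = word q l * word q l' := by
  simp [word]

theorem isWord_nil : IsWord q [] := by simp [IsWord]

theorem isWord_cons {k : ℕ} {l : List ℕ} : IsWord q (k :: l) ↔ (1 ≤ k ∧ k < q) ∧ IsWord q l := by
  simp [IsWord]

theorem IsWord.append {l l' : List ℕ} (h : IsWord q l) (h' : IsWord q l') :
    IsWord q (l ++ l') := by
  intro k hk
  rcases List.mem_append.1 hk with hk | hk
  · exact h k hk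
  · exact h' k hk

/-- Conjugation by `S` exchanges words with inverses of words, because `V_k⁻¹ = S V_{q-k} S`. -/
theorem exists_word_inv (hq : 3 ≤ q) {l : List ℕ} (hl : IsWord q l) :
    ∃ l', IsWord q l' ∧ (word q l)⁻¹ = S * word q l' * S := by
  induction l with
  | nil => exact ⟨[], isWord_nil, by simp [S_mul_S]⟩
  | cons k l ih =>
    obtain ⟨⟨h1, h2⟩, hl⟩ := isWord_cons.1 hl
    obtain ⟨l', hl', h⟩ := ih hl
    refine ⟨l' ++ [q - k], hl'.append (isWord_cons.2 ⟨⟨by omega, by omega⟩, isWord_nil⟩), ?_⟩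
    rw [word_cons, _root_.mul_inv_rev, h, V_inv hq h2.le, word_append]
    simp only [word_cons, word_nil, mul_one, mul_assoc, S_mul_S_mul]

/-- Every element of the Hecke group is a word in the `V_k`, up to a factor `S` on either side:
the set of these elements is stable under left multiplication by `S` and by the `V_j`, because
`V_j S V_k` is `V_{j+k}`, `S` or `V_{j+k-q}`. -/
theorem exists_word_of_mem_heckeGroup (hq : 3 ≤ q) {g : PSL2R} (hg : g ∈ heckeGroup q) :
    ∃ l a b, IsWord q l ∧ (a = 1 ∨ a = S) ∧ (b = 1 ∨ b = S) ∧ g = a * word q l * b := by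
  have hS : ∀ {g}, (∃ l a b, IsWord q l ∧ (a = 1 ∨ a = S) ∧ (b = 1 ∨ b = S) ∧
      g = a * word q l * b) → ∃ l a b, IsWord q l ∧ (a = 1 ∨ a = S) ∧ (b = 1 ∨ b = S) ∧
      S * g = a * word q l * b := by
    rintro _ ⟨l, a, b, hl, rfl | rfl, hb, rfl⟩
    · exact ⟨l, S, b, hl, Or.inr rfl, hb, by simp [mul_assoc]⟩
    · exact ⟨l, 1, b, hl, Or.inl rfl, hb, by simp only [mul_assoc, S_mul_S_mul, one_mul]⟩
  have hV : ∀ {g} (j : ℕ), 1 ≤ j → j < q →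
      (∃ l a b, IsWord q l ∧ (a = 1 ∨ a = S) ∧ (b = 1 ∨ b = S) ∧ g = a * word q l * b) →
      ∃ l a b, IsWord q l ∧ (a = 1 ∨ a = S) ∧ (b = 1 ∨ b = S) ∧
      V q j * g = a * word q l * b := by
    rintro _ j h1 h2 ⟨l, a, b, hl, rfl | rfl, hb, rfl⟩
    · exact ⟨j :: l, 1, b, isWord_cons.2 ⟨⟨h1, h2⟩, hl⟩, Or.inl rfl, hb, by simp [mul_assoc]⟩
    · cases l with
      | nil =>
        refine ⟨[j], 1, S * b, isWord_cons.2 ⟨⟨h1, h2⟩, isWord_nil⟩, Or.inl rfl, ?_, by simp⟩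
        rcases hb with rfl | rfl
        · simp
        · simp [S_mul_S]
      | cons k l =>
        obtain ⟨⟨h3, h4⟩, hl⟩ := isWord_cons.1 hl
        have h : V q j * (S * word q (k :: l) * b) = V q (j + k) * word q l * b := by
          rw [← V_mul_S_mul_V, word_cons]
          simp only [mul_assoc]
        rw [h]
        rcases lt_trichotomy (j + k) q with hjk | hjk | hjk
        · exact ⟨(j + k) :: l, 1, b, isWord_cons.2 ⟨⟨by omega, hjk⟩, hl⟩, Or.inl rfl, hb, by simp⟩
        · exact ⟨l, S, b, hl, Or.inr rfl, hb, by rw [hjk, V_self hq]⟩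
        · refine ⟨(j + k - q) :: l, 1, b, isWord_cons.2 ⟨⟨by omega, by omega⟩, hl⟩, Or.inl rfl, hb,
            ?_⟩
          rw [show j + k = q + (j + k - q) by omega, V_add_self hq]
          simp
  induction hg using Subgroup.closure_induction_left with
  | one => exact ⟨[], 1, 1, isWord_nil, Or.inl rfl, Or.inl rfl, by simp⟩
  | mul_left x hx y _ ih =>
    rcases hx with rfl | hx
    · exact hS ih
    · rw [Set.mem_singleton_iff] at hx
      rw [hx, ← V_one]
      exact hV 1 le_rfl (by omega) ih
  | inv_mul_cancel x hx y _ ih =>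
    rcases hx with rfl | hx
    · rw [S_inv]
      exact hS ih
    · rw [Set.mem_singleton_iff] at hx
      rw [hx, ← V_one, V_inv hq (by omega), mul_assoc, mul_assoc]
      exact hS (hV (q - 1) (by omega) (by omega) (hS ih))

theorem mem_heckeGroup_cases (hq : 3 ≤ q) {g : PSL2R} (hg : g ∈ heckeGroup q) :
    ∃ l, IsWord q l ∧ (g = word q l ∨ g⁻¹ = word q l ∨ g = word q l * S ∨ g = S * word q l) := by
  obtain ⟨l, a, b, hl, rfl | rfl, rfl | rfl, rfl⟩ := exists_word_of_mem_heckeGroup hq hg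
  · exact ⟨l, hl, by simp⟩
  · exact ⟨l, hl, by simp⟩
  · exact ⟨l, hl, by simp⟩
  · obtain ⟨l', hl', h⟩ := exists_word_inv hq hl
    refine ⟨l', hl', Or.inr (Or.inl ?_)⟩
    rw [_root_.mul_inv_rev, _root_.mul_inv_rev, h, S_inv]
    simp only [mul_assoc, S_mul_S_mul, S_mul_S, mul_one]

theorem S_mem : S ∈ heckeGroup q := Subgroup.subset_closure (by simp)

theorem V_mem (k : ℕ) : V q k ∈ heckeGroup q := by
  have hT : T q ∈ heckeGroup q := Subgroup.subset_closure (by simp)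
  exact mul_mem (pow_mem (mul_mem hT S_mem) k) S_mem

theorem word_mem (l : List ℕ) : word q l ∈ heckeGroup q := by
  induction l with
  | nil => exact one_mem _
  | cons k l ih =>
    rw [word_cons]
    exact mul_mem (V_mem k) ih

/-! ### Entries of words -/

/-- The properties of the nonnegative matrix of a word of length `n` in the `V_k`: its entries are
zero or at least one, the diagonal ones being nonzero, and their sum is at least `n + 2`. -/
structure IsGrowing (X : SL2R) (n : ℕ) : Prop where
  entry : ∀ i j, X i j = 0 ∨ 1 ≤ X i j
  one_le_a : 1 ≤ X 0 0
  one_le_d : 1 ≤ X 1 1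
  sum : 2 + (n : ℝ) ≤ X 0 0 + X 0 1 + X 1 0 + X 1 1

theorem IsGrowing.nonneg {X : SL2R} {n : ℕ} (h : IsGrowing X n) (i j) : 0 ≤ X i j := by
  rcases h.entry i j with h | h <;> linarith

theorem zero_or_one_le_mul_add {a b x y : ℝ} (ha : a = 0 ∨ 1 ≤ a) (hb : b = 0 ∨ 1 ≤ b)
    (hx : x = 0 ∨ 1 ≤ x) (hy : y = 0 ∨ 1 ≤ y) : a * x + b * y = 0 ∨ 1 ≤ a * x + b * y := by
  rcases ha with rfl | ha <;> rcases hb with rfl | hb <;> rcases hx with rfl | hx <;>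
    rcases hy with rfl | hy <;> (try simp only [mul_zero, zero_mul, add_zero, zero_add, true_or])
  all_goals right; nlinarith

/-- Every word has such a representative: left multiplication by the matrix of `V_k`, which has
diagonal entries and a further entry at least one, increases the sum of the entries by at least
one. -/
theorem exists_isGrowing (hq : 3 ≤ q) {l : List ℕ} (hl : IsWord q l) :
    ∃ X : SL2R, (X : PSL2R) = word q l ∧ IsGrowing X l.length := by
  induction l with
  | nil =>
    refine ⟨1, rfl, ⟨?_, by simp, by simp, ?_⟩⟩
    · intro i j
      fin_cases i <;> fin_cases j <;> simp
    · simp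
      norm_num
  | cons k l ih =>
    obtain ⟨⟨h1, h2⟩, hl⟩ := isWord_cons.1 hl
    obtain ⟨X, hX, hg⟩ := ih hl
    refine ⟨Vmat hq k * X, by rw [QuotientGroup.mk_mul, mk_Vmat, hX, word_cons], ?_⟩
    have e0 := sn_eq_zero_or_one_le hq (k := k) h2.le
    have e1 := sn_eq_zero_or_one_le hq (k := k + 1) h2
    have e2 := sn_eq_zero_or_one_le hq (k := k - 1) (by omega)
    have e3 := one_le_sn_nat hq h1 h2
    -- one of the two neighbouring entries is nonzero, since `q ≥ 3`
    have e4 : 1 ≤ sn q ((k + 1 : ℕ) : ℝ) ∨ 1 ≤ sn q ((k - 1 : ℕ) : ℝ) := by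
      rcases Nat.lt_or_ge (k + 1) q with h | h
      · exact Or.inl (one_le_sn_nat hq (by omega) h)
      · exact Or.inr (one_le_sn_nat hq (by omega) (by omega))
    rw [Nat.cast_sub h1, Nat.cast_one] at e2 e4
    rw [Nat.cast_add, Nat.cast_one] at e1 e4
    have g00 : (Vmat hq k * X) 0 0 = sn q k * X 0 0 + sn q (k + 1) * X 1 0 := by
      simp [sl_mul_apply]
    have g01 : (Vmat hq k * X) 0 1 = sn q k * X 0 1 + sn q (k + 1) * X 1 1 := by
      simp [sl_mul_apply]
    have g10 : (Vmat hq k * X) 1 0 = sn q (k - 1) * X 0 0 + sn q k * X 1 0 := by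
      simp [sl_mul_apply]
    have g11 : (Vmat hq k * X) 1 1 = sn q (k - 1) * X 0 1 + sn q k * X 1 1 := by
      simp [sl_mul_apply]
    have n01 := hg.nonneg 0 1
    have n10 := hg.nonneg 1 0
    have a1 := hg.one_le_a
    have d1 := hg.one_le_d
    have s1 : 0 ≤ sn q ((k : ℝ) + 1) := by rcases e1 with h | h <;> linarith
    have s2 : 0 ≤ sn q ((k : ℝ) - 1) := by rcases e2 with h | h <;> linarith
    have hsum := hg.sum
    refine ⟨?_, ?_, ?_, ?_⟩
    · intro i j
      fin_cases i <;> fin_cases j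
      · exact g00 ▸ zero_or_one_le_mul_add e0 e1 (hg.entry 0 0) (hg.entry 1 0)
      · exact g01 ▸ zero_or_one_le_mul_add e0 e1 (hg.entry 0 1) (hg.entry 1 1)
      · exact g10 ▸ zero_or_one_le_mul_add e2 e0 (hg.entry 0 0) (hg.entry 1 0)
      · exact g11 ▸ zero_or_one_le_mul_add e2 e0 (hg.entry 0 1) (hg.entry 1 1)
    · rw [g00]
      nlinarith [mul_nonneg s1 n10]
    · rw [g11]
      nlinarith [mul_nonneg s2 n01]
    · rw [g00, g01, g10, g11, List.length_cons, Nat.cast_add, Nat.cast_one]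
      have t1 : X 0 0 + X 0 1 ≤ sn q k * (X 0 0 + X 0 1) := by nlinarith
      have t2 : X 1 0 + X 1 1 ≤ sn q k * (X 1 0 + X 1 1) := by nlinarith
      have t3 : 1 ≤ sn q (k + 1) * (X 1 0 + X 1 1) + sn q (k - 1) * (X 0 0 + X 0 1) := by
        rcases e4 with h | h
        · nlinarith [mul_nonneg s2 (by linarith : 0 ≤ X 0 0 + X 0 1)]
        · nlinarith [mul_nonneg s1 (by linarith : 0 ≤ X 1 0 + X 1 1)]
      linarith

theorem eq_nil_of_word_eq_one (hq : 3 ≤ q) {l : List ℕ} (hl : IsWord q l) (h : word q l = 1) :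
    l = [] := by
  obtain ⟨X, hX, hg⟩ := exists_isGrowing hq hl
  rw [h, ← QuotientGroup.mk_one, mk_eq_mk_iff] at hX
  have hsum := hg.sum
  have ha := hg.one_le_a
  have hX' : X = 1 := by
    rcases hX with hX | hX
    · exact hX.symm
    · have h00 : (1 : SL2R) 0 0 = -X 0 0 := by rw [hX]; simp
      simp at h00
      linarith
  rw [hX'] at hsum
  simp at hsum
  rw [← List.length_eq_zero_iff]
  have : (l.length : ℝ) ≤ 0 := by linarith
  exact_mod_cast le_antisymm this (Nat.cast_nonneg _)

/-- Discreteness of the Hecke group: nonzero matrix entries have absolute value at least one. -/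
theorem exists_entries_of_mem_heckeGroup (hq : 3 ≤ q) {g : PSL2R} (hg : g ∈ heckeGroup q) :
    ∃ X : SL2R, (X : PSL2R) = g ∧ ∀ i j, X i j = 0 ∨ 1 ≤ |X i j| := by
  obtain ⟨l, a, b, hl, ha, hb, rfl⟩ := exists_word_of_mem_heckeGroup hq hg
  obtain ⟨X, hX, hXg⟩ := exists_isGrowing hq hl
  have h : ∀ i j, X i j = 0 ∨ 1 ≤ |X i j| := fun i j => by
    rcases hXg.entry i j with h | h
    · exact Or.inl h
    · exact Or.inr (h.trans (le_abs_self _))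
  have left : ∃ Y : SL2R, (Y : PSL2R) = a * word q l ∧ ∀ i j, Y i j = 0 ∨ 1 ≤ |Y i j| := by
    rcases ha with rfl | rfl
    · exact ⟨X, by rw [hX, one_mul], h⟩
    · refine ⟨Smat * X, by rw [QuotientGroup.mk_mul, hX, mk_Smat], ?_⟩
      intro i j
      fin_cases i <;> fin_cases j <;>
        simpa [sl_mul_apply] using h _ _
  obtain ⟨Y, hY, h⟩ := left
  rcases hb with rfl | rfl
  · exact ⟨Y, by rw [hY, mul_one], h⟩
  · refine ⟨Y * Smat, by rw [QuotientGroup.mk_mul, hY, mk_Smat], ?_⟩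
    intro i j
    fin_cases i <;> fin_cases j <;>
      simpa [sl_mul_apply] using h _ _

/-! ### Action of words on the positive and the negative half-line -/

theorem S_smul_pt {u v : ℝ} (h : u ≠ 0 ∨ v ≠ 0) : S • pt u v = pt v (-u) := by
  refine (mk_smul_pt _ h).trans ?_
  simp

theorem isNeg_S_smul {x : OnePoint ℝ} : IsNeg (S • x) ↔ IsPos x := by
  obtain ⟨u, v, h, rfl⟩ := exists_pt x
  rw [S_smul_pt h, isNeg_pt, isPos_pt]
  constructor <;> intro h <;> linarith

theorem isPos_S_smul {x : OnePoint ℝ} : IsPos (S • x) ↔ IsNeg x := by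
  obtain ⟨u, v, h, rfl⟩ := exists_pt x
  rw [S_smul_pt h, isNeg_pt, isPos_pt]
  constructor <;> intro h <;> linarith

theorem IsPos.word_smul (hq : 3 ≤ q) {l : List ℕ} (hl : IsWord q l) {x : OnePoint ℝ}
    (hx : IsPos x) : IsPos (word q l • x) := by
  obtain ⟨X, hX, hg⟩ := exists_isGrowing hq hl
  obtain ⟨u, v, h, rfl⟩ := exists_pt x
  rw [isPos_pt] at hx
  rw [← hX, mk_smul_pt X h, isPos_pt]
  have ha := hg.one_le_a
  have hd := hg.one_le_d
  have hb := hg.nonneg 0 1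
  have hc := hg.nonneg 1 0
  have h1 : 1 ≤ X 0 0 * X 1 1 := by nlinarith
  have h2 : 0 < X 0 0 * X 1 1 * (u * v) := mul_pos (by linarith) hx
  have h3 : 0 ≤ X 0 1 * X 1 0 * (u * v) := by positivity
  have h4 : 0 ≤ X 0 0 * X 1 0 * (u * u) :=
    mul_nonneg (mul_nonneg (by linarith) hc) (mul_self_nonneg u)
  have h5 : 0 ≤ X 0 1 * X 1 1 * (v * v) :=
    mul_nonneg (mul_nonneg hb (by linarith)) (mul_self_nonneg v)
  nlinarith

theorem IsNeg.word_inv_smul (hq : 3 ≤ q) {l : List ℕ} (hl : IsWord q l) {x : OnePoint ℝ}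
    (hx : IsNeg x) : IsNeg ((word q l)⁻¹ • x) := by
  obtain ⟨l', hl', h⟩ := exists_word_inv hq hl
  rw [h, mul_assoc, mul_smul, mul_smul, isNeg_S_smul]
  exact (isPos_S_smul.2 hx).word_smul hq hl'

theorem IsNeg.V_inv_smul (hq : 3 ≤ q) {k : ℕ} (h1 : 1 ≤ k) (h2 : k < q) {x : OnePoint ℝ}
    (hx : IsNeg x) : IsNeg ((V q k)⁻¹ • x) := by
  have := hx.word_inv_smul hq (l := [k]) (isWord_cons.2 ⟨⟨h1, h2⟩, isWord_nil⟩)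
  simpa using this

/-! ### The intervals -/

/-- The `k`-th interval is the image under `V_k = g_k⁻¹` of the positive half-line. -/
theorem inInterval_iff (hq : 3 ≤ q) {k : ℕ} (h1 : 1 ≤ k) (h2 : k < q) (x : OnePoint ℝ) :
    InInterval q k x ↔ IsPos ((V q k)⁻¹ • x) := by
  have hk := one_le_sn_nat hq h1 h2
  have hc : 0 ≤ sn q ((k : ℝ) - 1) := by
    have e2 := sn_eq_zero_or_one_le hq (k := k - 1) (by omega)
    rw [Nat.cast_sub h1, Nat.cast_one] at e2
    rcases e2 with h | h <;> linarith
  have hdet := sn_sq hq k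
  have e0 : (gElt q k)⁻¹ • ((0 : ℝ) : OnePoint ℝ)
      = ((sn q (k + 1) / sn q k : ℝ) : OnePoint ℝ) := by
    rw [gElt_inv, ← mk_Vmat hq, ← pt_one, mk_smul_pt _ (by simp)]
    have : sn q k ≠ 0 := by linarith
    simp [pt, this]
  have e1 : (gElt q k)⁻¹ • (∞ : OnePoint ℝ) = pt (sn q k) (sn q (k - 1)) := by
    rw [gElt_inv, ← mk_Vmat hq, ← pt_zero 1, mk_smul_pt _ (by simp)]
    simp
  have e2 : ∀ u v : ℝ, (u ≠ 0 ∨ v ≠ 0) → (V q k)⁻¹ • pt u v =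
      pt (sn q k * u - sn q (k + 1) * v) (sn q k * v - sn q (k - 1) * u) := by
    intro u v h
    rw [← mk_Vmat hq, ← QuotientGroup.mk_inv, mk_smul_pt _ h,
      Matrix.SpecialLinearGroup.SL2_inv_expl]
    simp
    congr 1
    all_goals ring
  unfold InInterval
  rw [e0, e1]
  induction x using OnePoint.rec with
  | infty =>
    rw [← pt_zero 1, e2 _ _ (by simp), isPos_pt, pt_zero]
    constructor
    · rintro ⟨_, h⟩
      rw [toOrd_infty] at h
      exact absurd h not_top_lt
    · intro h
      nlinarith
  | coe r =>
    rw [← pt_one r, e2 _ _ (by simp), isPos_pt, pt_one, toOrd_coe, toOrd_coe, WithTop.coe_lt_coe,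
      div_lt_iff₀ (by linarith)]
    have e3 : (r : WithTop ℝ) < toOrd (pt (sn q k) (sn q (k - 1))) ↔
        r * sn q (k - 1) < sn q k := by
      unfold pt
      split_ifs with h
      · rw [toOrd_infty, h, mul_zero]
        exact iff_of_true (WithTop.coe_lt_top r) (by linarith)
      · rw [toOrd_coe, WithTop.coe_lt_coe, lt_div_iff₀ (lt_of_le_of_ne hc (Ne.symm h))]
    rw [e3]
    constructor
    · rintro ⟨h3, h4⟩
      exact mul_pos (by linarith) (by linarith)
    · intro h
      rcases pos_and_pos_or_neg_and_neg_of_mul_pos h with h | h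
      · exact ⟨by linarith [h.1], by linarith [h.2]⟩
      · -- both factors negative would contradict the determinant
        exfalso
        nlinarith [mul_nonneg hc (by linarith [h.1] : 0 ≤ sn q (k + 1) - sn q k * r),
          mul_nonneg (by linarith : 0 ≤ sn q k) (by linarith [h.2] : 0 ≤ sn q (k - 1) * r - sn q k)]

/-- The intervals are pairwise disjoint: if `z = V_k⁻¹ x` and `V_l⁻¹ x = S V_j S z` with
`j ∈ {1, …, q - 1}`. -/
theorem interval_unique (hq : 3 ≤ q) {k l : ℕ} (hk : k < q) (hl : l < q)
    {x : OnePoint ℝ} (h : IsPos ((V q k)⁻¹ • x)) (h' : IsPos ((V q l)⁻¹ • x)) : k = l := by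
  wlog hkl : l ≤ k generalizing k l
  · exact (this hl hk h' h (le_of_not_ge hkl)).symm
  by_contra hne
  have e : (V q l)⁻¹ • x = S • word q [k - l] • (V q k)⁻¹ • x := by
    rw [word_cons, word_nil, mul_one, ← mul_smul, ← mul_smul]
    congr 1
    rw [eq_mul_inv_iff_mul_eq, inv_mul_eq_iff_eq_mul, ← mul_assoc, V_mul_S_mul_V,
      Nat.add_sub_cancel' hkl]
  rw [e, isPos_S_smul] at h'
  exact (h.word_smul hq (isWord_cons.2 ⟨⟨by omega, by omega⟩, isWord_nil⟩)).not_isNeg h'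

theorem mem_interval_iff (hq : 3 ≤ q) {k : ℕ} {x : OnePoint ℝ} :
    k ∈ interval q x ↔ (1 ≤ k ∧ k < q) ∧ IsPos ((V q k)⁻¹ • x) := by
  classical
  unfold interval
  rw [Part.mem_mk_iff]
  constructor
  · rintro ⟨h, rfl⟩
    have := Nat.find_spec h
    exact ⟨⟨this.1, this.2.1⟩, (inInterval_iff hq this.1 this.2.1 x).1 this.2.2⟩
  · rintro ⟨⟨h1, h2⟩, h3⟩
    have h : ∃ k, 1 ≤ k ∧ k < q ∧ InInterval q k x :=
      ⟨k, h1, h2, (inInterval_iff hq h1 h2 x).2 h3⟩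
    have := Nat.find_spec h
    exact ⟨h, interval_unique hq this.2.1 h2
      ((inInterval_iff hq this.1 this.2.1 x).1 this.2.2) h3⟩

/-- The intervals cover `(0, ∞)` up to their endpoints. -/
theorem exists_mem_interval (hq : 3 ≤ q) {x : OnePoint ℝ} (hx : IsPos x)
    (h : ∀ k, (V q k)⁻¹ • x ≠ ∞) : ∃ k, k ∈ interval q x := by
  classical
  obtain ⟨r, hr, rfl⟩ := hx
  -- `k` is the first index with `V_k 0 < r`
  have hex : ∃ k : ℕ, sn q (k + 1) < r * sn q k := by
    refine ⟨q - 1, ?_⟩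
    have := one_le_sn_nat hq (k := q - 1) (by omega) (by omega)
    have h0 := sn_self hq
    rw [Nat.cast_sub (by omega), Nat.cast_one] at this ⊢
    rw [sub_add_cancel, h0]
    exact mul_pos hr (by linarith)
  set k := Nat.find hex with hkdef
  have hk : sn q (k + 1) < r * sn q k := Nat.find_spec hex
  have hkq : k ≤ q - 1 := by
    apply Nat.find_min' hex
    have := one_le_sn_nat hq (k := q - 1) (by omega) (by omega)
    have h0 := sn_self hq
    rw [Nat.cast_sub (by omega), Nat.cast_one] at this ⊢
    rw [sub_add_cancel, h0]
    exact mul_pos hr (by linarith)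
  have hk0 : 1 ≤ k := by
    by_contra hlt
    have h0 : k = 0 := by omega
    rw [h0] at hk
    simp [sn_zero, sn_one hq] at hk
    linarith
  have hmin := Nat.find_min hex (m := k - 1) (by omega)
  rw [Nat.cast_sub hk0, Nat.cast_one, sub_add_cancel, not_lt] at hmin
  refine ⟨k, (mem_interval_iff hq).2 ⟨⟨hk0, by omega⟩, ?_⟩⟩
  have e : (V q k)⁻¹ • ((r : ℝ) : OnePoint ℝ) =
      pt (sn q k * r - sn q (k + 1)) (sn q k - sn q (k - 1) * r) := by
    rw [← mk_Vmat hq, ← QuotientGroup.mk_inv, ← pt_one, mk_smul_pt _ (by simp),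
      Matrix.SpecialLinearGroup.SL2_inv_expl]
    simp
    congr 1
    all_goals ring
  have hne := h k
  rw [e] at hne ⊢
  rw [isPos_pt]
  refine mul_pos (by linarith) (lt_of_le_of_ne (by linarith) ?_)
  intro h0
  rw [← h0, pt_zero] at hne
  exact hne rfl


/-! ### Coefficients of `Γ_q`-forms -/

theorem smul_mem_gammaForms {g : PSL2R} (hg : g ∈ heckeGroup q) {F : POQF}
    (hF : F ∈ gammaForms q) : g • F ∈ gammaForms q :=
  ⟨by rw [POQF.psi_smul]; exact mul_mem (mul_mem hg hF.1) (inv_mem hg), POQF.isHyp_psi _⟩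

/-- A matrix of determinant one with a vanishing off-diagonal entry and diagonal entries of absolute
value at least one is not hyperbolic. -/
theorem not_isHyperbolic_of_entries {X : SL2R} (h : X 1 0 = 0 ∨ X 0 1 = 0)
    (hX : ∀ i j, X i j = 0 ∨ 1 ≤ |X i j|) :
    ¬ (X : Matrix (Fin 2) (Fin 2) ℝ).IsHyperbolic := by
  have hdet := X.det_coe
  rw [Matrix.det_fin_two] at hdet
  unfold Matrix.IsHyperbolic
  rw [Matrix.discr_fin_two, Matrix.trace_fin_two, Matrix.det_fin_two]
  have had : X 0 0 * X 1 1 = 1 := by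
    rcases h with h | h <;> rw [h] at hdet <;> linarith
  have ha : 1 ≤ |X 0 0| := (hX 0 0).resolve_left (by intro h0; simp [h0] at had)
  have hd : 1 ≤ |X 1 1| := (hX 1 1).resolve_left (by intro h0; simp [h0] at had)
  have habs : |X 0 0| * |X 1 1| = 1 := by rw [← abs_mul, had, abs_one]
  have ha' : |X 0 0| = 1 := by nlinarith
  have hd' : |X 1 1| = 1 := by nlinarith
  have ha2 : X 0 0 ^ 2 = 1 := by rw [← sq_abs, ha', one_pow]
  have hd2 : X 1 1 ^ 2 = 1 := by rw [← sq_abs, hd', one_pow]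
  rw [hdet]
  nlinarith

theorem one_le_abs_coeff (hq : 3 ≤ q) {f : QF} (hf : POQF.mk f 1 ∈ gammaForms q) :
    1 ≤ |f.A| ∧ 1 ≤ |f.C| := by
  obtain ⟨X, hX, h⟩ := exists_entries_of_mem_heckeGroup hq hf.1
  have hY : ∀ i j, OQF.toSL (f, 1) i j = 0 ∨ 1 ≤ |OQF.toSL (f, 1) i j| := by
    intro i j
    rw [POQF.psi_mk, mk_eq_mk_iff] at hX
    rcases hX with hX | hX
    · rw [hX]
      exact h i j
    · rw [hX]
      simpa using h i j
  have hhyp := POQF.isHyperbolic_toSL (f, 1)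
  have hA := (hY 1 0).resolve_left fun h0 => not_isHyperbolic_of_entries (Or.inl h0) hY hhyp
  have hC := (hY 0 1).resolve_left fun h0 => not_isHyperbolic_of_entries (Or.inr h0) hY hhyp
  exact ⟨by simpa [OQF.toSL] using hA, by simpa [OQF.toSL] using hC⟩

theorem IsEigen.mul_ne_zero {f : QF} {s u v : ℝ} (h : IsEigen f s u v) (hA : f.A ≠ 0)
    (hC : f.C ≠ 0) : u * v ≠ 0 := by
  obtain ⟨h0, h1, h2⟩ := h
  rw [Ne, _root_.mul_eq_zero]
  rintro (rfl | rfl)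
  · have : f.C * v = 0 := by linarith
    simp_all
  · have : f.A * u = 0 := by linarith
    simp_all

theorem isPos_or_isNeg_pt {u v : ℝ} (h : u * v ≠ 0) : IsPos (pt u v) ∨ IsNeg (pt u v) := by
  rw [isPos_pt, isNeg_pt]
  exact (lt_or_gt_of_ne h).symm

theorem isPos_or_isNeg_zeros (hq : 3 ≤ q) {F : POQF} (hF : F ∈ gammaForms q) :
    (IsPos F.attr ∨ IsNeg F.attr) ∧ (IsPos F.rep ∨ IsNeg F.rep) := by
  obtain ⟨f, rfl⟩ := F.exists_eq_mk_one
  obtain ⟨hA, hC⟩ := one_le_abs_coeff hq hF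
  have hA' : f.A ≠ 0 := abs_pos.1 (by linarith)
  have hC' : f.C ≠ 0 := abs_pos.1 (by linarith)
  obtain ⟨u, v, e, hx⟩ := f.exists_isEigen_xPlus
  obtain ⟨u', v', e', hx'⟩ := f.exists_isEigen_xMinus
  rw [POQF.attr_mk_one, POQF.rep_mk_one, hx, hx']
  exact ⟨isPos_or_isNeg_pt (e.mul_ne_zero hA' hC'), isPos_or_isNeg_pt (e'.mul_ne_zero hA' hC')⟩

theorem isReduced_iff (hq : 3 ≤ q) {F : POQF} (hF : F ∈ gammaForms q) :
    F.IsReduced ↔ IsPos F.attr ∧ IsNeg F.rep := by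
  unfold POQF.IsReduced
  rw [toOrd_pos_iff, toOrd_neg_iff]
  have h : F.attr ≠ ∞ := by
    intro h
    rcases (isPos_or_isNeg_zeros hq hF).1 with ⟨r, -, hr⟩ | ⟨r, -, hr⟩ <;>
      exact OnePoint.coe_ne_infty r (hr.symm.trans h)
  simp [h]

/-- The coefficients of a form in terms of homogeneous coordinates of its zeros. -/
theorem IsEigen.coeffs {f : QF} {u v u' v' : ℝ} (h : IsEigen f 1 u v)
    (h' : IsEigen f (-1) u' v') :
    f.A * (u * v' - u' * v) = √f.D * (v * v') ∧
    -f.B * (u * v' - u' * v) = √f.D * (u * v' + u' * v) ∧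
    f.C * (u * v' - u' * v) = √f.D * (u * u') := by
  refine ⟨?_, ?_, ?_⟩
  · linear_combination (v' / 2) * h.snd - (v / 2) * h'.snd
  · linear_combination v' * h.fst - v * h'.fst
  · linear_combination (u' / 2) * h.fst - (u / 2) * h'.fst

/-- Normalized by `s = 1`, a reduced form has positive first and negative last coefficient. -/
theorem coeff_signs_of_isReduced {f : QF} (ha : IsPos (POQF.mk f 1).attr)
    (hr : IsNeg (POQF.mk f 1).rep) : 0 < f.A ∧ f.C < 0 := by
  obtain ⟨u, v, e, hx⟩ := f.exists_isEigen_xPlus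
  obtain ⟨u', v', e', hx'⟩ := f.exists_isEigen_xMinus
  rw [POQF.attr_mk_one, hx, isPos_pt] at ha
  rw [POQF.rep_mk_one, hx', isNeg_pt] at hr
  obtain ⟨h1, -, h3⟩ := e.coeffs e'
  have hne := e.indep e'
  have hD := f.sqrt_D_pos
  have hpos : 0 < (u * v' - u' * v) ^ 2 := by positivity
  have hv : 0 < v ^ 2 := sq_pos_of_ne_zero (right_ne_zero_of_mul ha.ne')
  have hu : 0 < u ^ 2 := sq_pos_of_ne_zero (left_ne_zero_of_mul ha.ne')
  constructor
  · refine pos_of_mul_pos_left ?_ hpos.le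
    have : f.A * (u * v' - u' * v) ^ 2 = √f.D * (u * v * v' ^ 2 - u' * v' * v ^ 2) := by
      linear_combination (u * v' - u' * v) * h1
    rw [this]
    apply mul_pos hD
    nlinarith [mul_nonneg ha.le (sq_nonneg v'), mul_pos (neg_pos.2 hr) hv]
  · refine neg_of_mul_neg_left ?_ hpos.le
    have : f.C * (u * v' - u' * v) ^ 2 = -(√f.D * (u * v * u' ^ 2 - u' * v' * u ^ 2)) := by
      linear_combination (u * v' - u' * v) * h3
    rw [this, neg_lt_zero]
    apply mul_pos hD
    nlinarith [mul_nonneg ha.le (sq_nonneg u'), mul_pos (neg_pos.2 hr) hu]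

theorem coeff_signs_of_isPos {f : QF} (ha : IsPos (POQF.mk f 1).attr)
    (hr : IsPos (POQF.mk f 1).rep) : 0 < f.A * f.C ∧ f.A * f.B < 0 := by
  obtain ⟨u, v, e, hx⟩ := f.exists_isEigen_xPlus
  obtain ⟨u', v', e', hx'⟩ := f.exists_isEigen_xMinus
  rw [POQF.attr_mk_one, hx, isPos_pt] at ha
  rw [POQF.rep_mk_one, hx', isPos_pt] at hr
  obtain ⟨h1, h2, h3⟩ := e.coeffs e'
  have hne := e.indep e'
  have hD := f.sqrt_D_pos
  have hpos : 0 < (u * v' - u' * v) ^ 2 := by positivity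
  have hv : 0 < v ^ 2 := sq_pos_of_ne_zero (right_ne_zero_of_mul ha.ne')
  constructor
  · refine pos_of_mul_pos_left ?_ hpos.le
    have : f.A * f.C * (u * v' - u' * v) ^ 2 = √f.D ^ 2 * ((u * v) * (u' * v')) := by
      linear_combination (f.C * (u * v' - u' * v)) * h1 + √f.D * (v * v') * h3
    rw [this]
    positivity
  · refine neg_of_mul_neg_left ?_ hpos.le
    have : f.A * f.B * (u * v' - u' * v) ^ 2 =
        -(√f.D ^ 2 * (u * v * v' ^ 2 + u' * v' * v ^ 2)) := by
      linear_combination (f.B * (u * v' - u' * v)) * h1 - √f.D * (v * v') * h2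
    rw [this, neg_lt_zero]
    apply mul_pos (by positivity)
    nlinarith [mul_nonneg ha.le (sq_nonneg v'), mul_pos hr hv]

/-! ### Termination of the preperiod -/

theorem POQF.mk_one_injective {f f' : QF} (h : POQF.mk f 1 = POQF.mk f' 1) : f = f' := by
  rcases (Quotient.exact h : OQF.setoid.r (f, 1) (f', 1)) with h | h
  · exact (Prod.mk.inj h).1.symm
  · exact absurd (Prod.mk.inj h).2 (show (1 : ℤˣ) ≠ -1 by decide)

/-- If both zeros of `w⁻¹ F` are positive, for a word `w`, the length of `w` is bounded in terms of
`F`: the coefficients `A, -B, C` of `w⁻¹ F` have the same sign and `|A|, |C| ≥ 1`, so no cancellation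
occurs in the formulas for the outer coefficients of `F = w (w⁻¹ F)`, which therefore exceed the
sums of the squares of the entries of `w`. -/
theorem length_le_of_isPos (hq : 3 ≤ q) {f : QF} (hf : POQF.mk f 1 ∈ gammaForms q) {l : List ℕ}
    (hl : IsWord q l) (ha : IsPos ((word q l)⁻¹ • POQF.mk f 1).attr)
    (hr : IsPos ((word q l)⁻¹ • POQF.mk f 1).rep) : (l.length : ℝ) ≤ |f.A| + |f.C| := by
  obtain ⟨X, hX, hg⟩ := exists_isGrowing hq hl
  have hE := smul_mem_gammaForms (inv_mem (word_mem l)) hf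
  obtain ⟨e, he⟩ := ((word q l)⁻¹ • POQF.mk f 1).exists_eq_mk_one
  rw [he] at ha hr hE
  obtain ⟨hA, hC⟩ := one_le_abs_coeff hq hE
  obtain ⟨hAC, hAB⟩ := coeff_signs_of_isPos ha hr
  rw [inv_smul_eq_iff, ← hX, POQF.psl_smul_mk] at he
  have hfe := POQF.mk_one_injective he
  have sq_le : ∀ i j, X i j ≤ X i j ^ 2 := by
    intro i j
    rcases hg.entry i j with h | h
    · simp [h]
    · nlinarith
  have n00 := hg.nonneg 0 0
  have n01 := hg.nonneg 0 1
  have n10 := hg.nonneg 1 0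
  have n11 := hg.nonneg 1 1
  -- the bound for coefficients `a = |A|`, `b = -|B|`, `c = |C|`
  have key : ∀ a b c : ℝ, 1 ≤ a → 1 ≤ c → b ≤ 0 → (l.length : ℝ) ≤
      (a * X 1 1 ^ 2 - b * X 1 0 * X 1 1 + c * X 1 0 ^ 2) +
      (a * X 0 1 ^ 2 - b * X 0 1 * X 0 0 + c * X 0 0 ^ 2) := by
    intro a b c ha hc hb
    have b1 : 0 ≤ -b * (X 1 0 * X 1 1) := mul_nonneg (by linarith) (mul_nonneg n10 n11)
    have b2 : 0 ≤ -b * (X 0 1 * X 0 0) := mul_nonneg (by linarith) (mul_nonneg n01 n00)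
    have c1 : X 1 1 ^ 2 ≤ a * X 1 1 ^ 2 := le_mul_of_one_le_left (sq_nonneg _) ha
    have c2 : X 0 1 ^ 2 ≤ a * X 0 1 ^ 2 := le_mul_of_one_le_left (sq_nonneg _) ha
    have c3 : X 1 0 ^ 2 ≤ c * X 1 0 ^ 2 := le_mul_of_one_le_left (sq_nonneg _) hc
    have c4 : X 0 0 ^ 2 ≤ c * X 0 0 ^ 2 := le_mul_of_one_le_left (sq_nonneg _) hc
    have := hg.sum
    have := sq_le 0 0
    have := sq_le 0 1
    have := sq_le 1 0
    have := sq_le 1 1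
    linarith
  rw [hfe, QF.smul_A, QF.smul_C]
  rcases lt_or_ge 0 e.A with hpos | hneg
  · have hCpos : 0 < e.C := pos_of_mul_pos_right hAC hpos.le
    have hBneg : e.B < 0 := neg_of_mul_neg_right hAB hpos.le
    rw [abs_of_pos hpos] at hA
    rw [abs_of_pos hCpos] at hC
    exact (key _ _ _ hA hC hBneg.le).trans (add_le_add (le_abs_self _) (le_abs_self _))
  · have hCneg : e.C < 0 := neg_of_mul_pos_right hAC hneg
    have hBpos : 0 < e.B := pos_of_mul_neg_right hAB hneg
    rw [abs_of_nonpos hneg] at hA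
    rw [abs_of_neg hCneg] at hC
    refine (key _ (-e.B) _ hA hC (by linarith)).trans (le_trans (le_of_eq ?_)
      (add_le_add (neg_le_abs _) (neg_le_abs _)))
    ring

/-! ### The reduction step on reduced forms -/

/-- The attracting zero `x` is not an endpoint of the intervals, since `V_k⁻¹ x` is the attracting
zero of the `Γ_q`-form `V_k⁻¹ F`, hence different from `∞`. -/
theorem exists_mem_interval_attr (hq : 3 ≤ q) {F : POQF} (hF : F ∈ gammaForms q)
    (hpos : IsPos F.attr) : ∃ k, k ∈ interval q F.attr := by
  apply exists_mem_interval hq hpos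
  intro k h
  rw [← POQF.attr_smul] at h
  rcases (isPos_or_isNeg_zeros hq (smul_mem_gammaForms (inv_mem (V_mem k)) hF)).1 with
    ⟨r, -, hr⟩ | ⟨r, -, hr⟩ <;> exact OnePoint.coe_ne_infty r (hr.symm.trans h)

open Classical in
/-- The interval of the attracting zero as a total function (`0` where it is undefined). -/
def index (q : ℕ) (F : POQF) : ℕ :=
  if h : (interval q F.attr).Dom then (interval q F.attr).get h else 0

/-- One reduction step `F ↦ g_k F`, with `k` the interval of the attracting zero. -/
def next (q : ℕ) (F : POQF) : POQF := (V q (index q F))⁻¹ • F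

theorem index_eq {F : POQF} {k : ℕ} (hk : k ∈ interval q F.attr) : index q F = k := by
  have h : (interval q F.attr).Dom := Part.dom_iff_mem.2 ⟨k, hk⟩
  unfold index
  rw [dif_pos h]
  exact Part.get_eq_of_mem hk h

/-- `F` is a reduced `Γ_q`-form. -/
structure IsRed (q : ℕ) (F : POQF) : Prop where
  mem : F ∈ gammaForms q
  attr_pos : IsPos F.attr
  rep_neg : IsNeg F.rep

theorem isRed_iff (hq : 3 ≤ q) {F : POQF} : IsRed q F ↔ F ∈ gammaForms q ∧ F.IsReduced := by
  constructor
  · intro h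
    exact ⟨h.mem, (isReduced_iff hq h.mem).2 ⟨h.attr_pos, h.rep_neg⟩⟩
  · rintro ⟨h, h'⟩
    obtain ⟨h1, h2⟩ := (isReduced_iff hq h).1 h'
    exact ⟨h, h1, h2⟩

theorem index_mem (hq : 3 ≤ q) {F : POQF} (hF : F ∈ gammaForms q) (hpos : IsPos F.attr) :
    index q F ∈ interval q F.attr := by
  obtain ⟨k, hk⟩ := exists_mem_interval_attr hq hF hpos
  rwa [index_eq hk]

theorem IsRed.next (hq : 3 ≤ q) {F : POQF} (hF : IsRed q F) : IsRed q (next q F) := by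
  obtain ⟨⟨h1, h2⟩, h3⟩ := (mem_interval_iff hq).1 (index_mem hq hF.mem hF.attr_pos)
  refine ⟨smul_mem_gammaForms (inv_mem (V_mem _)) hF.mem, ?_, ?_⟩
  · rwa [HeckeReduction.next, POQF.attr_smul]
  · rw [HeckeReduction.next, POQF.rep_smul]
    exact hF.rep_neg.V_inv_smul hq h1 h2

theorem IsRed.iterate (hq : 3 ≤ q) {F : POQF} (hF : IsRed q F) (n : ℕ) :
    IsRed q ((HeckeReduction.next q)^[n] F) := by
  induction n with
  | zero => exact hF
  | succ n ih =>
    rw [Function.iterate_succ_apply']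
    exact ih.next hq

/-- The first `n` indices occurring in the iterated reduction of `F`. -/
def itinerary (q : ℕ) (F : POQF) : ℕ → List ℕ
  | 0 => []
  | n + 1 => index q F :: itinerary q (next q F) n

theorem itinerary_add (F : POQF) (m n : ℕ) :
    itinerary q F (m + n) = itinerary q F m ++ itinerary q ((next q)^[m] F) n := by
  induction m generalizing F with
  | zero => simp [itinerary]
  | succ m ih =>
    rw [show m + 1 + n = (m + n) + 1 by omega]
    simp [itinerary, ih]

theorem word_itinerary_succ (F : POQF) (n : ℕ) : word q (itinerary q F (n + 1)) =
    word q (itinerary q F n) * V q (index q ((next q)^[n] F)) := by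
  rw [itinerary_add, word_append]
  simp [itinerary]

theorem word_itinerary_smul (F : POQF) (n : ℕ) :
    word q (itinerary q F n) • (next q)^[n] F = F := by
  induction n with
  | zero => simp [itinerary]
  | succ n ih =>
    rw [word_itinerary_succ, Function.iterate_succ_apply', mul_smul]
    conv_lhs => rw [next, smul_inv_smul]
    exact ih

theorem isWord_itinerary (hq : 3 ≤ q) {F : POQF} (hF : IsRed q F) (n : ℕ) :
    IsWord q (itinerary q F n) := by
  induction n generalizing F with
  | zero => exact isWord_nil
  | succ n ih =>
    exact isWord_cons.2 ⟨((mem_interval_iff hq).1 (index_mem hq hF.mem hF.attr_pos)).1,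
      ih (hF.next hq)⟩

/-- A word relating two reduced forms is an initial segment of the itinerary. -/
theorem eq_itinerary_of_word_smul (hq : 3 ≤ q) {l : List ℕ} (hl : IsWord q l) {E F : POQF}
    (hE : IsRed q E) (hF : IsRed q F) (h : word q l • F = E) :
    l = itinerary q E l.length ∧ (next q)^[l.length] E = F := by
  induction l generalizing E with
  | nil =>
    rw [word_nil, one_smul] at h
    exact ⟨rfl, h.symm⟩
  | cons k l ih =>
    obtain ⟨hk, hl⟩ := isWord_cons.1 hl
    rw [word_cons, mul_smul] at h
    have h' : word q l • F = (V q k)⁻¹ • E := by rw [← h, inv_smul_smul]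
    have hmem : k ∈ interval q E.attr := by
      rw [mem_interval_iff hq]
      refine ⟨hk, ?_⟩
      rw [← POQF.attr_smul, ← h', POQF.attr_smul]
      exact hF.attr_pos.word_smul hq hl
    have hi := index_eq hmem
    have hn : next q E = (V q k)⁻¹ • E := by rw [next, hi]
    obtain ⟨h1, h2⟩ := ih hl (hE.next hq) (h'.trans hn.symm)
    refine ⟨?_, ?_⟩
    · rw [List.length_cons, itinerary, hi, ← h1]
    · rw [List.length_cons, Function.iterate_succ_apply, h2]

/-- The hyperbolic element of a reduced form is a nonempty word in the `V_k`. -/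
theorem IsRed.exists_psi_eq_word (hq : 3 ≤ q) {F : POQF} (hF : IsRed q F) :
    ∃ l, IsWord q l ∧ l ≠ [] ∧ F.psi = word q l := by
  have hfa : F.psi • F.attr = F.attr := by rw [← POQF.attr_smul, POQF.psi_smul_self]
  have hfr : F.psi • F.rep = F.rep := by rw [← POQF.rep_smul, POQF.psi_smul_self]
  have hapos := hF.attr_pos
  have hrneg := hF.rep_neg
  obtain ⟨l, hl, h | h | h | h⟩ := mem_heckeGroup_cases hq hF.mem.1
  · refine ⟨l, hl, ?_, h⟩
    rintro rfl
    have hhyp := F.isHyp_psi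
    rw [h, word_nil, ← QuotientGroup.mk_one, isHyp_mk] at hhyp
    refine not_isHyperbolic_of_entries (Or.inl (by simp)) (fun i j => ?_) hhyp
    fin_cases i <;> fin_cases j <;> simp
  · -- The inverse of `ψ(F)`, normalized to have positive trace, has negative off-diagonal entries.
    exfalso
    obtain ⟨X, hX, hg⟩ := exists_isGrowing hq hl
    obtain ⟨f, rfl⟩ := F.exists_eq_mk_one
    obtain ⟨hA, hC⟩ := coeff_signs_of_isReduced hapos hrneg
    rw [← h, POQF.psi_mk, ← QuotientGroup.mk_inv, eq_comm, mk_eq_mk_iff] at hX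
    have hD : 0 < f.D := f.indefinite
    have hs : 0 < √(f.D + 4) := Real.sqrt_pos.2 (by linarith)
    have n00 := hg.nonneg 0 0
    have n11 := hg.nonneg 1 1
    have n10 := hg.nonneg 1 0
    have i00 : (OQF.toSL (f, 1))⁻¹ 0 0 = (f.B + √(f.D + 4)) / 2 := by
      rw [Matrix.SpecialLinearGroup.coe_inv, Matrix.adjugate_fin_two]
      simp [OQF.toSL]
    have i11 : (OQF.toSL (f, 1))⁻¹ 1 1 = (-f.B + √(f.D + 4)) / 2 := by
      rw [Matrix.SpecialLinearGroup.coe_inv, Matrix.adjugate_fin_two]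
      simp [OQF.toSL]
    have i10 : (OQF.toSL (f, 1))⁻¹ 1 0 = -f.A := by
      rw [Matrix.SpecialLinearGroup.coe_inv, Matrix.adjugate_fin_two]
      simp [OQF.toSL]
    rcases hX with rfl | rfl
    · linarith
    · rw [Matrix.SpecialLinearGroup.coe_neg, Matrix.neg_apply] at n00 n11
      linarith
  · exfalso
    rw [h, mul_smul] at hfr
    have := (isPos_S_smul.2 hrneg).word_smul hq hl
    rw [hfr] at this
    exact this.not_isNeg hrneg
  · exfalso
    rw [h, mul_smul] at hfa
    have := isNeg_S_smul.2 (hapos.word_smul hq hl)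
    rw [hfa] at this
    exact hapos.not_isNeg this

theorem IsRed.mem_periodicPts (hq : 3 ≤ q) {F : POQF} (hF : IsRed q F) :
    F ∈ Function.periodicPts (HeckeReduction.next q) := by
  obtain ⟨l, hl, hne, h⟩ := hF.exists_psi_eq_word hq
  have hfix := F.psi_smul_self
  rw [h] at hfix
  exact ⟨l.length, List.length_pos_iff.2 hne, (eq_itinerary_of_word_smul hq hl hF hF hfix).2⟩

/-- An equivalence between reduced forms is, up to inversion, given by a word in the `V_k`: the
other elements of the Hecke group map the positive half-line to the negative one or conversely. -/
theorem exists_word_of_smul_eq (hq : 3 ≤ q) {E F : POQF} (hE : IsRed q E) (hF : IsRed q F)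
    {g : PSL2R} (hg : g ∈ heckeGroup q) (h : g • F = E) :
    ∃ l, IsWord q l ∧ (g = word q l ∨ g⁻¹ = word q l) := by
  obtain ⟨l, hl, hc | hc | hc | hc⟩ := mem_heckeGroup_cases hq hg
  · exact ⟨l, hl, Or.inl hc⟩
  · exact ⟨l, hl, Or.inr hc⟩
  · exfalso
    have h1 : IsPos E.rep := by
      rw [← h, POQF.rep_smul, hc, mul_smul]
      exact (isPos_S_smul.2 hF.rep_neg).word_smul hq hl
    exact h1.not_isNeg hE.rep_neg
  · exfalso
    have h1 : IsNeg E.attr := by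
      rw [← h, POQF.attr_smul, hc, mul_smul]
      exact isNeg_S_smul.2 (hF.attr_pos.word_smul hq hl)
    exact hE.attr_pos.not_isNeg h1

/-- Equivalent reduced forms lie on the same cycle. -/
theorem exists_iterate_eq_of_smul_eq (hq : 3 ≤ q) {E F : POQF} (hE : IsRed q E) (hF : IsRed q F)
    {g : PSL2R} (hg : g ∈ heckeGroup q) (h : g • F = E) : ∃ i, (next q)^[i] F = E := by
  obtain ⟨l, hl, hc | hc⟩ := exists_word_of_smul_eq hq hE hF hg h
  · rw [hc] at h
    have h2 := (eq_itinerary_of_word_smul hq hl hE hF h).2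
    obtain ⟨r, hr, hper⟩ := hE.mem_periodicPts hq
    refine ⟨r * l.length - l.length, ?_⟩
    rw [← h2, ← Function.iterate_add_apply, Nat.sub_add_cancel (Nat.le_mul_of_pos_left _ hr)]
    exact hper.mul_const l.length
  · rw [smul_eq_iff_eq_inv_smul, hc] at h
    exact ⟨_, (eq_itinerary_of_word_smul hq hl hF hE h.symm).2⟩

/-- The element `a_p` of the period of a reduced form `F`: the product of the `V_k` over one run
through the cycle of `F`. -/
def primitiveElt (q : ℕ) (F : POQF) : PSL2R :=
  word q (itinerary q F (Function.minimalPeriod (next q) F))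

theorem word_itinerary_mul (F : POQF) (t : ℕ) :
    word q (itinerary q F (Function.minimalPeriod (next q) F * t)) = primitiveElt q F ^ t := by
  induction t with
  | zero => simp [itinerary]
  | succ t ih =>
    have : (next q)^[Function.minimalPeriod (next q) F * t] F = F :=
      (Function.isPeriodicPt_minimalPeriod (next q) F).mul_const t
    rw [Nat.mul_succ, itinerary_add, word_append, this, ih, pow_succ]
    rfl

theorem exists_word_eq_pow (hq : 3 ≤ q) {l : List ℕ} (hl : IsWord q l) {F : POQF}
    (hF : IsRed q F) (h : word q l • F = F) : ∃ t : ℕ, word q l = primitiveElt q F ^ t := by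
  obtain ⟨h1, h2⟩ := eq_itinerary_of_word_smul hq hl hF hF h
  obtain ⟨t, ht⟩ := Function.IsPeriodicPt.minimalPeriod_dvd (f := next q) h2
  refine ⟨t, ?_⟩
  rw [← word_itinerary_mul, ← ht, ← h1]

/-- The hyperbolic element of a reduced form is a power of the period element. -/
theorem IsRed.exists_psi_eq_pow (hq : 3 ≤ q) {F : POQF} (hF : IsRed q F) :
    ∃ t : ℕ, 1 ≤ t ∧ F.psi = primitiveElt q F ^ t := by
  obtain ⟨l, hl, hne, h⟩ := hF.exists_psi_eq_word hq
  have hfix := F.psi_smul_self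
  rw [h] at hfix
  obtain ⟨t, ht⟩ := exists_word_eq_pow hq hl hF hfix
  refine ⟨t, Nat.one_le_iff_ne_zero.2 ?_, h.trans ht⟩
  rintro rfl
  rw [pow_zero] at ht
  exact hne (eq_nil_of_word_eq_one hq hl ht)

theorem primitiveElt_pow_eq_one (hq : 3 ≤ q) {F : POQF} (hF : IsRed q F) {t : ℕ}
    (h : primitiveElt q F ^ t = 1) : t = 0 := by
  rw [← word_itinerary_mul] at h
  have h1 := eq_nil_of_word_eq_one hq (isWord_itinerary hq hF _) h
  have hlen : ∀ (F : POQF) (n : ℕ), (itinerary q F n).length = n := by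
    intro F n
    induction n generalizing F with
    | zero => rfl
    | succ n ih => rw [itinerary, List.length_cons, ih]
  have h2 := hlen F (Function.minimalPeriod (next q) F * t)
  rw [h1, List.length_nil, eq_comm, _root_.mul_eq_zero] at h2
  exact h2.resolve_left (Function.minimalPeriod_pos_of_mem_periodicPts (hF.mem_periodicPts hq)).ne'

theorem primitiveElt_pow_injective (hq : 3 ≤ q) {F : POQF} (hF : IsRed q F) :
    Function.Injective fun t : ℕ => primitiveElt q F ^ t := by
  rw [injective_pow_iff_not_isOfFinOrder, isOfFinOrder_iff_pow_eq_one]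
  rintro ⟨n, hn, h⟩
  exact hn.ne' (primitiveElt_pow_eq_one hq hF h)

/-- If `ψ(F) = a^n` with the period element `a`, then `n` is the level of `F`: an `N`-th root of
`ψ(F)` in the Hecke group fixes `F`, hence is itself a power of `a`. -/
theorem IsRed.isLevel (hq : 3 ≤ q) {F : POQF} (hF : IsRed q F) {n : ℕ} (hn : 1 ≤ n)
    (h : F.psi = primitiveElt q F ^ n) : IsLevel q F n := by
  refine ⟨⟨hn, primitiveElt q F, word_mem _, h⟩, ?_⟩
  rintro N ⟨hN, g, hg, hgN⟩
  have hfix : g • F = F := by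
    rw [POQF.smul_eq_self_iff, hgN]
    exact Commute.self_pow g N
  obtain ⟨l, hl, hc | hc⟩ := exists_word_of_smul_eq hq hF hF hg hfix
  · rw [hc] at hfix hgN
    obtain ⟨t, ht⟩ := exists_word_eq_pow hq hl hF hfix
    rw [ht, ← pow_mul, h] at hgN
    have hnt : n = t * N := primitiveElt_pow_injective hq hF hgN
    exact Nat.le_of_dvd hn ⟨t, by rw [hnt, mul_comm]⟩
  · exfalso
    have hfix' : word q l • F = F := by rw [← hc, inv_smul_eq_iff, hfix]
    obtain ⟨t, ht⟩ := exists_word_eq_pow hq hl hF hfix'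
    rw [ht] at hc
    have h1 : primitiveElt q F ^ (n + t * N) = 1 := by
      rw [pow_add, ← h, pow_mul, ← hc, hgN, inv_pow, mul_inv_cancel]
    have := primitiveElt_pow_eq_one hq hF h1
    omega

theorem IsLevel.smul {F : POQF} {n : ℕ} (h : IsLevel q F n) {g : PSL2R}
    (hg : g ∈ heckeGroup q) : IsLevel q (g • F) n := by
  have key : ∀ {F : POQF} {g : PSL2R} {N : ℕ}, g ∈ heckeGroup q →
      (∃ h ∈ heckeGroup q, F.psi = h ^ N) → ∃ h ∈ heckeGroup q, (g • F).psi = h ^ N := by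
    rintro F g N hg ⟨h, hh, e⟩
    exact ⟨g * h * g⁻¹, mul_mem (mul_mem hg hh) (inv_mem hg), by rw [POQF.psi_smul, e, conj_pow]⟩
  refine ⟨⟨h.1.1, key hg h.1.2⟩, ?_⟩
  rintro N ⟨hN, hr⟩
  have := key (inv_mem hg) hr
  rw [inv_smul_smul] at this
  exact h.2 ⟨hN, this⟩


/-! ### Correctness of the loops -/

/-- Total correctness of a loop with invariant `I` and variant `μ`. -/
theorem exists_mem_whileLoop {σ : Type} {cond : σ → Prop} {body : σ → Part σ} (I : σ → Prop)
    (μ : σ → ℕ) (step : ∀ s, I s → cond s → ∃ s' ∈ body s, I s' ∧ μ s' < μ s) {s : σ} (hs : I s) :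
    ∃ s' ∈ whileLoop cond body s, I s' ∧ ¬ cond s' := by
  classical
  induction hn : μ s using Nat.strong_induction_on generalizing s with
  | _ n ih =>
    by_cases hc : cond s
    · obtain ⟨s', hs', hI, hlt⟩ := step s hs hc
      obtain ⟨t, ht, h⟩ := ih (μ s') (hn ▸ hlt) hI rfl
      refine ⟨t, ?_, h⟩
      unfold whileLoop at ht ⊢
      refine PFun.mem_fix_iff.2 (Or.inr ⟨s', ?_, ht⟩)
      rw [if_pos hc]
      exact Part.mem_map _ hs'
    · refine ⟨s, ?_, hs, hc⟩
      unfold whileLoop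
      refine PFun.mem_fix_iff.2 (Or.inl ?_)
      rw [if_neg hc]
      exact Part.mem_some _

/-- The invariant of the preperiod loop for the input `F`; the loop is entered at time `j₀` with the
form `F₁`. -/
structure PreInv (q : ℕ) (F F₁ : POQF) (j₀ : ℕ) (s : State) : Prop where
  zero : s.F 0 = F
  h_mem : ∀ i ≤ s.j, s.h i ∈ heckeGroup q
  F_eq : ∀ i ≤ s.j, s.F i = (s.h i)⁻¹ • F
  not_red : ∀ i < s.j, ¬ (s.F i).IsReduced
  xy : s.xy s.j = (s.F s.j).zeros
  attr_pos : IsPos (s.F s.j).attr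
  word : ∃ l, IsWord q l ∧ s.F s.j = (word q l)⁻¹ • F₁ ∧ s.j = j₀ + l.length

theorem PreInv.mem {F F₁ : POQF} (hF : F ∈ gammaForms q) {j₀ : ℕ} {s : State}
    (h : PreInv q F F₁ j₀ s) {i : ℕ} (hi : i ≤ s.j) : s.F i ∈ gammaForms q := by
  rw [h.F_eq i hi]
  exact smul_mem_gammaForms (inv_mem (h.h_mem i hi)) hF

theorem PreInv.exists_step (hq : 3 ≤ q) {F F₁ : POQF} (hF : F ∈ gammaForms q) {j₀ : ℕ}
    {s : State} (h : PreInv q F F₁ j₀ s) (hc : ¬ (s.F s.j).IsReduced) :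
    ∃ s' ∈ preperiodBody q s, PreInv q F F₁ j₀ s' ∧ s'.j = s.j + 1 := by
  obtain ⟨k, hk⟩ := exists_mem_interval_attr hq (h.mem hF le_rfl) h.attr_pos
  have hk' : k ∈ interval q (s.xy s.j).1 := by
    rw [h.xy]
    exact hk
  obtain ⟨hkb, hkpos⟩ := (mem_interval_iff hq).1 hk
  refine ⟨_, Part.mem_map _ hk', ⟨?_, ?_, ?_, ?_, ?_, ?_, ?_⟩, rfl⟩
  · simpa only [Function.update_of_ne (show 0 ≠ s.j + 1 by omega)] using h.zero
  · intro i hi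
    rcases (show i ≤ s.j + 1 from hi).lt_or_eq with hi | rfl
    · simpa [Function.update_of_ne hi.ne] using h.h_mem i (by omega)
    · simpa [gElt_inv] using mul_mem (h.h_mem s.j le_rfl) (V_mem k)
  · intro i hi
    rcases (show i ≤ s.j + 1 from hi).lt_or_eq with hi | rfl
    · simpa [Function.update_of_ne hi.ne] using h.F_eq i (by omega)
    · simp only [Function.update_self]
      rw [h.F_eq s.j le_rfl, _root_.mul_inv_rev, inv_inv, mul_smul]
  · intro i hi
    have hi : i < s.j + 1 := hi
    simp only [Function.update_of_ne hi.ne]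
    rcases (Nat.lt_succ_iff.1 hi).lt_or_eq with hi | rfl
    · exact h.not_red i hi
    · exact hc
  · simp only [Function.update_self]
    rw [POQF.zeros_smul, h.xy]
  · simp only [Function.update_self]
    rw [POQF.attr_smul]
    exact hkpos
  · obtain ⟨l, hl, h1, h2⟩ := h.word
    refine ⟨l ++ [k], hl.append (isWord_cons.2 ⟨hkb, isWord_nil⟩), ?_, ?_⟩
    · simp only [Function.update_self]
      rw [h1, word_append, _root_.mul_inv_rev, mul_smul, word_cons, word_nil, mul_one]
      rfl
    · simp [h2, add_assoc]

theorem exists_preInv_enforcePositive (hq : 3 ≤ q) {F : POQF} (hF : F ∈ gammaForms q) :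
    ∃ F₁ j₀, F₁ ∈ gammaForms q ∧ PreInv q F F₁ j₀ (enforcePositive (initState F)) := by
  unfold enforcePositive
  split_ifs with hneg
  · have hneg : IsNeg F.attr := toOrd_neg_iff.1 hneg
    have hS : S ∈ heckeGroup q := S_mem
    refine ⟨S • F, 1, smul_mem_gammaForms hS hF, ⟨?_, ?_, ?_, ?_, ?_, ?_, ?_⟩⟩
    · simp [initState]
    · intro i hi
      rcases (show i ≤ 1 from hi).lt_or_eq with hi | rfl
      · simp [Function.update_of_ne hi.ne, initState, one_mem]
      · simpa using hS
    · intro i hi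
      rcases (show i ≤ 1 from hi).lt_or_eq with hi | rfl
      · simp [Function.update_of_ne hi.ne, initState]
      · simp [initState, S_inv]
    · intro i hi
      have hi : i < 1 := hi
      simp only [Function.update_of_ne hi.ne]
      intro hr
      exact ((isReduced_iff hq hF).1 hr).1.not_isNeg hneg
    · simp only [Function.update_self]
      exact (POQF.zeros_smul S F).symm
    · simp only [Function.update_self]
      change IsPos (S • F).attr
      rw [POQF.attr_smul]
      exact isPos_S_smul.2 hneg
    · exact ⟨[], isWord_nil, by simp [initState], by simp⟩
  · have hpos : IsPos F.attr := (isPos_or_isNeg_zeros hq hF).1.resolve_right fun h =>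
      hneg (toOrd_neg_iff.2 h)
    exact ⟨F, 0, hF, rfl, fun i _ => one_mem _, fun i _ => by simp [initState],
      fun i hi => absurd hi (Nat.not_lt_zero i), rfl, hpos, [], isWord_nil, by simp [initState],
      by simp [initState]⟩

/-- The preperiod loop terminates: as long as the current form is not reduced, both of its zeros are
positive, and `length_le_of_isPos` bounds the number of passes. -/
theorem exists_preperiod (hq : 3 ≤ q) {F : POQF} (hF : F ∈ gammaForms q) :
    ∃ s ∈ whileLoop (fun s : State => ¬ (s.F s.j).IsReduced) (preperiodBody q)
      (enforcePositive (initState F)), ∃ F₁ j₀, PreInv q F F₁ j₀ s ∧ IsRed q (s.F s.j) := by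
  obtain ⟨F₁, j₀, hF₁, hinit⟩ := exists_preInv_enforcePositive hq hF
  obtain ⟨f, rfl⟩ := F₁.exists_eq_mk_one
  obtain ⟨N, hN⟩ := exists_nat_ge (|f.A| + |f.C|)
  obtain ⟨s, hs, hI, hc⟩ := exists_mem_whileLoop (cond := fun s : State => ¬ (s.F s.j).IsReduced)
    (body := preperiodBody q) (PreInv q F (POQF.mk f 1) j₀) (fun s => N + 1 + j₀ - s.j) (by
      intro s hs hc
      obtain ⟨s', hs', hI, hj⟩ := hs.exists_step hq hF hc
      refine ⟨s', hs', hI, ?_⟩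
      have hmem := hs.mem hF le_rfl
      have hrep : IsPos (s.F s.j).rep := (isPos_or_isNeg_zeros hq hmem).2.resolve_right fun h =>
        hc ((isReduced_iff hq hmem).2 ⟨hs.attr_pos, h⟩)
      have hattr := hs.attr_pos
      obtain ⟨l, hl, h1, h2⟩ := hs.word
      rw [h1] at hattr hrep
      have hlen : l.length ≤ N := by
        exact_mod_cast (length_le_of_isPos hq hF₁ hl hattr hrep).trans hN
      rw [hj]
      omega) hinit
  exact ⟨s, hs, _, _, hI, (isRed_iff hq).2 ⟨hI.mem hF le_rfl, not_not.1 hc⟩⟩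

/-- The invariant of the period loop, entered in the state `s₀` with the reduced form `R`, after `t`
passes. -/
structure PerInv (q : ℕ) (R : POQF) (s₀ : State) (t : ℕ) (s : State) : Prop where
  m_eq : s.m = s₀.m
  h_eq : s.h = s₀.h
  j_eq : s.j = s₀.m + t
  F_pre : ∀ i ≤ s₀.m, s.F i = s₀.F i
  F_eq : ∀ i ≤ t, s.F (s₀.m + i) = (next q)^[i] R
  xy_eq : ∀ i ≤ t, s.xy (s₀.m + i) = ((next q)^[i] R).zeros
  a_eq : s.a t = word q (itinerary q R t)
  ne : ∀ i, 1 ≤ i → i < t → (next q)^[i] R ≠ R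

theorem PerInv.exists_step (hq : 3 ≤ q) {R : POQF} (hR : IsRed q R) {s₀ s : State} {t : ℕ}
    (h : PerInv q R s₀ t s) (hne : 1 ≤ t → (next q)^[t] R ≠ R) :
    ∃ s' ∈ periodBody q s, PerInv q R s₀ (t + 1) s' := by
  have hRt := hR.iterate hq t
  have hk := index_mem hq hRt.mem hRt.attr_pos
  have hk' : index q ((next q)^[t] R) ∈ interval q (s.xy s.j).1 := by
    rw [h.j_eq, h.xy_eq t le_rfl]
    exact hk
  have hj := h.j_eq
  refine ⟨_, Part.mem_map _ hk', ⟨h.m_eq, h.h_eq, ?_, ?_, ?_, ?_, ?_, ?_⟩⟩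
  · change s.j + 1 = _
    omega
  · intro i hi
    exact (Function.update_of_ne (by omega) _ _).trans (h.F_pre i hi)
  · intro i hi
    rcases hi.lt_or_eq with hi | rfl
    · exact (Function.update_of_ne (by omega) _ _).trans (h.F_eq i (by omega))
    · simp only [hj, ← add_assoc, Function.update_self]
      rw [h.F_eq t le_rfl, Function.iterate_succ_apply']
      rfl
  · intro i hi
    rcases hi.lt_or_eq with hi | rfl
    · exact (Function.update_of_ne (by omega) _ _).trans (h.xy_eq i (by omega))
    · simp only [hj, ← add_assoc, Function.update_self]
      rw [h.xy_eq t le_rfl, Function.iterate_succ_apply', ← POQF.zeros_smul]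
      rfl
  · have h1 : s₀.m + t + 1 - s₀.m = t + 1 := by omega
    have h2 : s₀.m + t - s₀.m = t := by omega
    simp only [hj, h.m_eq, h1, h2, Function.update_self]
    rw [h.a_eq, gElt_inv, word_itinerary_succ]
  · intro i h1 h2
    rcases (Nat.lt_succ_iff.1 h2).lt_or_eq with hi | rfl
    · exact h.ne i h1 hi
    · exact hne h1

/-- The stopping condition of the period loop compares zeros, which amounts to comparing forms. -/
theorem iterate_next_eq_iff (R : POQF) (t : ℕ) :
    ((next q)^[t] R).zeros = R.zeros ↔ (next q)^[t] R = R := by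
  have h : (next q)^[t] R = (word q (itinerary q R t))⁻¹ • R := by
    rw [eq_inv_smul_iff, word_itinerary_smul]
  rw [h]
  exact ⟨POQF.smul_eq_of_zeros_eq, fun h => by rw [h]⟩

/-- The period loop terminates after as many passes as the minimal period of `R` indicates. -/
theorem exists_period (hq : 3 ≤ q) {R : POQF} (hR : IsRed q R) {s₀ : State}
    (h₀ : PerInv q R s₀ 0 s₀) :
    ∃ s ∈ repeatUntil (periodBody q) (fun s : State => s.xy s.j = s.xy s.m) s₀,
      PerInv q R s₀ (Function.minimalPeriod (next q) R) s := by
  set p := Function.minimalPeriod (next q) R with hp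
  have hp0 : 0 < p := Function.minimalPeriod_pos_of_mem_periodicPts (hR.mem_periodicPts hq)
  have hpR : (next q)^[p] R = R := Function.iterate_minimalPeriod
  have hcond : ∀ {t s}, PerInv q R s₀ t s → (s.xy s.j = s.xy s.m ↔ (next q)^[t] R = R) := by
    intro t s h
    rw [h.j_eq, h.m_eq, h.xy_eq t le_rfl, ← iterate_next_eq_iff]
    have := h.xy_eq 0 (Nat.zero_le _)
    rw [add_zero] at this
    rw [this]
    rfl
  have hle : ∀ {t s}, PerInv q R s₀ t s → t ≤ p := by
    intro t s h
    by_contra! hlt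
    exact h.ne p hp0 hlt hpR
  obtain ⟨s₁, hs₁, hI₁⟩ := h₀.exists_step hq hR (by omega)
  obtain ⟨s, hs, ⟨t, ht, hI⟩, hc⟩ := exists_mem_whileLoop
    (cond := fun s : State => ¬ s.xy s.j = s.xy s.m) (body := periodBody q)
    (fun s => ∃ t, 1 ≤ t ∧ PerInv q R s₀ t s) (fun s => s₀.m + p - s.j) (by
      rintro s ⟨t, ht, hI⟩ hc
      rw [hcond hI] at hc
      obtain ⟨s', hs', hI'⟩ := hI.exists_step hq hR fun _ => hc
      refine ⟨s', hs', ⟨t + 1, by omega, hI'⟩, ?_⟩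
      have := hle hI'
      rw [hI.j_eq, hI'.j_eq]
      omega) ⟨1, le_rfl, hI₁⟩
  rw [not_not, hcond hI] at hc
  have : t = p := le_antisymm (hle hI) (Function.IsPeriodicPt.minimalPeriod_le ht hc)
  exact ⟨s, Part.mem_bind hs₁ hs, this ▸ hI⟩

theorem test_iff {F : POQF} {s : State} : s.test F ↔ s.element = F.psi := POQF.psiInv_eq_iff

/-- The level loop terminates once some power of `a_p` passes the test. -/
theorem exists_level {F : POQF} {s : State} (hs : s.n = 1) {t : ℕ} (ht : 1 ≤ t)
    (h : s.h s.m * s.a s.p ^ t * (s.h s.m)⁻¹ = F.psi) :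
    ∃ s' ∈ whileLoop (fun s : State => ¬ s.test F)
      (fun s => Part.some { s with n := s.n + 1 }) s,
      ∃ n, 1 ≤ n ∧ s' = { s with n := n } ∧ s'.element = F.psi := by
  obtain ⟨s', hs', ⟨n, h1, h2, h3⟩, hc⟩ := exists_mem_whileLoop
    (cond := fun s : State => ¬ s.test F)
    (body := fun s => Part.some { s with n := s.n + 1 })
    (fun s' => ∃ n, 1 ≤ n ∧ n ≤ t ∧ s' = { s with n := n }) (fun s => t - s.n) (by
      rintro _ ⟨n, h1, h2, rfl⟩ hc
      refine ⟨_, Part.mem_some _, ⟨n + 1, by omega, ?_, rfl⟩, ?_⟩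
      · rw [test_iff] at hc
        have : n ≠ t := by
          rintro rfl
          exact hc h
        omega
      · rw [test_iff] at hc
        have : n ≠ t := by
          rintro rfl
          exact hc h
        change t - (n + 1) < t - n
        omega) ⟨1, le_rfl, ht, by rw [← hs]⟩
  rw [not_not, test_iff] at hc
  exact ⟨s', hs', n, h1, h3, hc⟩

/-- The algorithm terminates; the final state is described through its reduced form `F_m` and the
iterates of `next`. -/
theorem exists_final_state (hq : 3 ≤ q) {F : POQF} (hF : F ∈ gammaForms q) :
    ∃ s : State, (⟨s.n, (List.range (s.m + 1)).map s.F,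
        (List.range s.p).map fun i => s.F (s.m + 1 + i), s.element⟩ : Output) ∈
        reductionAlgorithm q F ∧
      s.F 0 = F ∧ (∀ i ≤ s.m, s.h i ∈ heckeGroup q ∧ s.F i = (s.h i)⁻¹ • F) ∧
      (∀ i < s.m, ¬ (s.F i).IsReduced) ∧ IsRed q (s.F s.m) ∧
      s.p = Function.minimalPeriod (next q) (s.F s.m) ∧
      (∀ i ≤ s.p, s.F (s.m + i) = (next q)^[i] (s.F s.m)) ∧
      1 ≤ s.n ∧ (s.F s.m).psi = primitiveElt q (s.F s.m) ^ s.n ∧ s.element = F.psi := by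
  obtain ⟨s₁, hs₁, F₁, j₀, hI, hR⟩ := exists_preperiod hq hF
  set R := s₁.F s₁.j with hRdef
  set s₁' : State := { s₁ with m := s₁.j, a := Function.update s₁.a 0 1 } with hs₁'
  obtain ⟨s₂, hs₂, hP⟩ := exists_period hq hR (s₀ := s₁') (by
    refine ⟨rfl, rfl, rfl, fun _ _ => rfl, ?_, ?_, ?_, fun i h1 h2 => by omega⟩
    · intro i hi
      obtain rfl : i = 0 := by omega
      rfl
    · intro i hi
      obtain rfl : i = 0 := by omega
      exact hI.xy
    · simp [hs₁', itinerary])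
  set p := Function.minimalPeriod (next q) R with hp
  have hm : s₂.m = s₁.j := hP.m_eq
  have hj : s₂.j = s₁.j + p := hP.j_eq
  have hh : s₂.h = s₁.h := hP.h_eq
  have hjm : s₂.j - s₂.m = p := by omega
  have hRF : R = (s₁.h s₁.j)⁻¹ • F := hI.F_eq _ le_rfl
  have hpsi : F.psi = s₁.h s₁.j * R.psi * (s₁.h s₁.j)⁻¹ := by
    rw [← POQF.psi_smul, hRF, smul_inv_smul]
  have ha : s₂.a (s₂.j - s₂.m) = primitiveElt q R := by
    rw [hjm]
    exact hP.a_eq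
  obtain ⟨t, ht, htR⟩ := hR.exists_psi_eq_pow hq
  obtain ⟨s₃, hs₃, n, hn, hs₃eq, helt⟩ := exists_level (F := F)
    (s := { s₂ with p := s₂.j - s₂.m, n := 1 }) rfl ht (by
      change s₂.h s₂.m * s₂.a (s₂.j - s₂.m) ^ t * (s₂.h s₂.m)⁻¹ = F.psi
      rw [ha, ← htR, hm, hh, hpsi])
  have hF₂ : s₂.F s₂.m = R := by
    rw [hm]
    exact hP.F_pre _ le_rfl
  refine ⟨s₃, Part.mem_bind hs₁ (Part.mem_bind hs₂ (Part.mem_bind hs₃ (Part.mem_some _))), ?_⟩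
  subst hs₃eq
  refine ⟨?_, ?_, ?_, ?_, ?_, ?_, hn, ?_, helt⟩
  · exact (hP.F_pre 0 (Nat.zero_le _)).trans hI.zero
  · intro i hi
    have hi : i ≤ s₁.j := by
      rw [← hm]
      exact hi
    change s₂.h i ∈ _ ∧ s₂.F i = (s₂.h i)⁻¹ • F
    rw [hh, hP.F_pre i hi]
    exact ⟨hI.h_mem i hi, hI.F_eq i hi⟩
  · intro i hi
    have hi : i < s₁.j := by
      rw [← hm]
      exact hi
    change ¬ (s₂.F i).IsReduced
    rw [hP.F_pre i hi.le]
    exact hI.not_red i hi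
  · change IsRed q (s₂.F s₂.m)
    rwa [hF₂]
  · change s₂.j - s₂.m = Function.minimalPeriod (next q) (s₂.F s₂.m)
    rw [hF₂, hjm]
  · intro i hi
    change s₂.F (s₂.m + i) = (next q)^[i] (s₂.F s₂.m)
    rw [hF₂, hm]
    refine hP.F_eq i ?_
    rw [← hjm]
    exact hi
  · change (s₂.F s₂.m).psi = primitiveElt q (s₂.F s₂.m) ^ n
    rw [hF₂]
    change s₂.h s₂.m * s₂.a (s₂.j - s₂.m) ^ n * (s₂.h s₂.m)⁻¹ = F.psi at helt
    rw [ha, hm, hh, hpsi] at helt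
    exact (mul_left_cancel (mul_right_cancel helt)).symm


end

end HeckeReduction

open HeckeReduction in
theorem mainTheorem1 (q : ℕ) (hq : 3 ≤ q) (F : POQF) (hF : F ∈ gammaForms q) :
    ∃ out ∈ reductionAlgorithm q F,
      -- the preperiod starts with `F`, consists of `Γ_q`-forms equivalent to `F`, and is
      -- non-reduced up to its last member `R`, which is reduced
      out.preperiod.head? = some F ∧
      (∀ E ∈ out.preperiod, E ∈ gammaForms q ∧ GammaEquiv q F E) ∧
      (∀ E ∈ out.preperiod.dropLast, ¬ E.IsReduced) ∧
      (∃ R : POQF, out.preperiod.getLast? = some R ∧ R.IsReduced ∧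
        -- the period is a cycle through `R`: it closes up at `R`, and each member is sent to the
        -- cyclically next one by `g_k`, where `k` is the interval of its attracting zero
        out.period.getLast? = some R) ∧
      (∀ (i : ℕ) (E E' : POQF), out.period[i]? = some E →
        out.period[(i + 1) % out.period.length]? = some E' →
        ∃ k ∈ interval q E.attr, E' = gElt q k • E) ∧
      -- its members are pairwise distinct, and they are exactly the reduced `Γ_q`-forms that are
      -- equivalent to `F`
      out.period.Nodup ∧
      (∀ E : POQF, E ∈ out.period ↔ E ∈ gammaForms q ∧ E.IsReduced ∧ GammaEquiv q F E) ∧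
      -- level and associated hyperbolic element
      IsLevel q F out.level ∧
      out.element = F.psi ∧ out.element ∈ heckeGroup q ∧ IsHyp out.element := by
  obtain ⟨s, hs, h0, hpre, hnr, hR, hp, hper, hn, hpsi, helt⟩ := exists_final_state hq hF
  set R := s.F s.m with hRdef
  have hp0 : 0 < s.p := hp ▸ Function.minimalPeriod_pos_of_mem_periodicPts (hR.mem_periodicPts hq)
  have hpR : (next q)^[s.p] R = R := hp ▸ Function.iterate_minimalPeriod
  have hmod : ∀ n, (next q)^[n % s.p] R = (next q)^[n] R := fun n =>
    hp ▸ Function.iterate_mod_minimalPeriod_eq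
  have hperiod : ((List.range s.p).map fun i => s.F (s.m + 1 + i)) =
      (List.range s.p).map fun i => (next q)^[i + 1] R := by
    apply List.map_congr_left
    intro i hi
    rw [List.mem_range] at hi
    rw [add_assoc, add_comm 1 i]
    exact hper (i + 1) hi
  have hRF : R = (s.h s.m)⁻¹ • F := (hpre s.m le_rfl).2
  have hmR : (s.h s.m)⁻¹ ∈ heckeGroup q := inv_mem (hpre s.m le_rfl).1
  refine ⟨_, hs, ?_, ?_, ?_, ⟨R, ?_, ?_, ?_⟩, ?_, ?_, ?_, ?_, helt, helt ▸ hF.1, helt ▸ hF.2⟩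
  · simp [List.range_succ_eq_map, h0]
  · intro E hE
    obtain ⟨i, hi, rfl⟩ := List.mem_map.1 hE
    obtain ⟨h1, h2⟩ := hpre i (Nat.lt_succ_iff.1 (List.mem_range.1 hi))
    rw [h2]
    exact ⟨smul_mem_gammaForms (inv_mem h1) hF, _, inv_mem h1, rfl⟩
  · intro E hE
    simp only [List.range_succ, List.map_append, List.map_cons, List.map_nil,
      List.dropLast_concat] at hE
    obtain ⟨i, hi, rfl⟩ := List.mem_map.1 hE
    exact hnr i (List.mem_range.1 hi)
  · simp [List.range_succ, hRdef]
  · exact ((isRed_iff hq).1 hR).2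
  · simp only [hperiod]
    obtain ⟨p', hp'⟩ := Nat.exists_eq_succ_of_ne_zero hp0.ne'
    rw [hp'] at hpR ⊢
    rw [List.range_succ, List.map_append, List.map_singleton, List.getLast?_concat]
    exact congrArg some hpR
  · intro i E E' hE hE'
    simp only [hperiod, List.length_map, List.length_range] at hE hE'
    rw [List.getElem?_map] at hE hE'
    have hi : i < s.p := by
      by_contra! hlt
      rw [List.getElem?_eq_none (by simpa using hlt)] at hE
      simp at hE
    rw [List.getElem?_range hi, Option.map_some, Option.some_inj] at hE
    rw [List.getElem?_range (Nat.mod_lt _ hp0), Option.map_some, Option.some_inj,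
      Function.iterate_succ_apply', hmod, hE] at hE'
    have hred : IsRed q E := hE ▸ hR.iterate hq (i + 1)
    exact ⟨_, index_mem hq hred.mem hred.attr_pos, hE'.symm⟩
  · simp only [hperiod]
    refine List.Nodup.map_on ?_ List.nodup_range
    intro i hi j hj hij
    rw [List.mem_range] at hi hj
    -- applying `p - 1` further steps cancels the first one
    have hij' := congrArg (next q)^[s.p - 1] hij
    rw [← Function.iterate_add_apply, ← Function.iterate_add_apply,
      show s.p - 1 + (i + 1) = i + s.p by omega, show s.p - 1 + (j + 1) = j + s.p by omega,
      Function.iterate_add_apply, Function.iterate_add_apply, hpR] at hij'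
    rw [hp] at hi hj
    exact (Function.iterate_eq_iterate_iff_of_lt_minimalPeriod hi hj).1 hij'
  · intro E
    simp only [hperiod]
    constructor
    · intro hE
      obtain ⟨i, -, rfl⟩ := List.mem_map.1 hE
      obtain ⟨h1, h2⟩ := (isRed_iff hq).1 (hR.iterate hq (i + 1))
      refine ⟨h1, h2, (word q (itinerary q R (i + 1)))⁻¹ * (s.h s.m)⁻¹,
        mul_mem (inv_mem (word_mem _)) hmR, ?_⟩
      rw [mul_smul, ← hRF, inv_smul_eq_iff, word_itinerary_smul]
    · rintro ⟨h1, h2, g, hg, rfl⟩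
      obtain ⟨i, hi⟩ := exists_iterate_eq_of_smul_eq hq ((isRed_iff hq).2 ⟨h1, h2⟩) hR
        (g := g * s.h s.m) (mul_mem hg (hpre s.m le_rfl).1) (by
          rw [hRF, mul_smul, smul_inv_smul])
      refine List.mem_map.2 ⟨(i + (s.p - 1)) % s.p, List.mem_range.2 (Nat.mod_lt _ hp0), ?_⟩
      rw [Function.iterate_succ_apply', hmod, ← Function.iterate_succ_apply' (next q),
        show (i + (s.p - 1)).succ = i + s.p by omega, Function.iterate_add_apply, hpR, hi]
  · have := (hR.isLevel hq hn hpsi).smul (inv_mem hmR)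
    rwa [hRF, inv_inv, smul_inv_smul] at this
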